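/- Let $l_1,l_2,l_3>0$ with $l_1+l_2+l_3=1$ and $a_1,a_2,a_3>0$. For $\tau\in[-\pi,\pi)$ write $\partial^{(\tau)}:=\frac{d}{dx}+i\tau$, $\xi_1:=e^{-i\tau(l_2+l_3)}$, $\xi_2:=e^{-i\tau l_2}$. **Fibre operator.** Consider the graph with two vertices $V_1,V_2$ and three edges $e^{(j)}\cong[0,l_j]$, where $e^{(1)},e^{(3)}$ run from $V_2$ to $V_1$ and $e^{(2)}$ runs from $V_1$ to $V_2$; the edges $e^{(1)},e^{(2)}$ are soft and $e^{(3)}$ is stiff. For $\varepsilon>0$ put $\kappa_1=a_1^2$, $\kappa_2=a_2^2$, $\kappa_3=a_3^2/\varepsilon^2$. In $H=L^2(0,l_1)\oplus L^2(0,l_2)\oplus L^2(0,l_3)$ let $A_\varepsilon^{(\tau)}$ act by $(A_\varepsilon^{(\tau)}u)_j=-\kappa_j(\partial^{(\tau)})^2u_j$ on the domain of all $u$ with $u_j\in W^{2,2}(0,l_j)$, $j=1,2,3$, that satisfy the weighted continuity conditions $$u_1(l_1)=u_2(0)=e^{i\tau(l_2+l_3)}u_3(l_3),\qquad e^{i\tau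 l_3}u_1(0)=u_2(l_2)=u_3(0)$$ and the weighted Kirchhoff conditions $$-\kappa_1\,\partial^{(\tau)}u_1|_{l_1}+\kappa_2\,\partial^{(\tau)}u_2|_0-e^{i\tau(l_2+l_3)}\kappa_3\,\partial^{(\tau)}u_3|_{l_3}=0,\qquad e^{i\tau l_3}\kappa_1\,\partial^{(\tau)}u_1|_0-\kappa_2\,\partial^{(\tau)}u_2|_{l_2}+\kappa_3\,\partial^{(\tau)}u_3|_0=0.$$ **Homogenised operator.** In $H_{\rm hom}=L^2(0,l_1)\oplus L^2(0,l_2)\oplus\mathbb C$ let $\mathcal A_{\rm hom}^{(\tau)}$ be given on the domain of all $(u_1,u_2,\beta)$ with $u_j\in W^{2,2}(0,l_j)$, $j=1,2$, and $$u_2(0)=\overline{\xi_2}\,u_2(l_2)=\overline{\xi_1}\,u_1(0)=u_1(l_1)=\beta/\sqrt{l_3}$$ by $$\mathcal A_{\rm hom}^{(\tau)}\begin{pmatrix}u_1\\u_2\\\beta\end{pmatrix}=\begin{pmatrix}-a_1^2(\partial^{(\tau)})^2u_1\\-a_2^2(\partial^{(\tau)})^2u_2\\-\frac1{\sqrt{l_3}}\bigl(a_2^2\,\partial^{(\tau)}u_2|_0-a_2^2\,\overline{\xi_2}\,\partial^{(\tau)}u_2|_{l_2}+a_1^2\,\overline{\xi_1}\,\partial^{(\tau)}u_1|_0-a_1^2\,\partial^{(\tau)}u_1|_{l_1}\bigr)\end{pmatrix}.$$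 Let $\Psi=\Psi^{(\tau)}:H\to H_{\rm hom}$ be the operator $$\Psi(u_1,u_2,u_3)=\Bigl(u_1,\,u_2,\,\tfrac1{\sqrt{l_3}}\int_0^{l_3}e^{i\tau(l_2+x)}u_3(x)\,dx\Bigr).$$ **Theorem.** For every $\tau\in[-\pi,\pi)$ the operator $\mathcal A_{\rm hom}^{(\tau)}$ is self-adjoint and $\Psi^{(\tau)}$ is a partial isometry. For every compact set $K\subset\mathbb C$ and every $\sigma>0$ there is a constant $C$ such that for all $\varepsilon>0$, all $\tau\in[-\pi,\pi)$ and all $z\in K_\sigma:=\{z\in K:\operatorname{dist}(z,\mathbb R)\ge\sigma\}$ the bounded resolvents $(A_\varepsilon^{(\tau)}-z)^{-1}$ and $(\mathcal A_{\rm hom}^{(\tau)}-z)^{-1}$ exist and $$\bigl\|(A_\varepsilon^{(\tau)}-z)^{-1}-\Psi^*(\mathcal A_{\rm hom}^{(\tau)}-z)^{-1}\Psi\bigr\|_{H\to H}\le C\varepsilon^2 .$$ -/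

import Mathlib

open MeasureTheory Set

noncomputable section

/-! ### Function spaces on an edge -/

/-- The complex Hilbert space `L²(0, ℓ)`. -/
abbrev EdgeL2 (ℓ : ℝ) : Type := Lp ℂ 2 (volume.restrict (Ioo (0 : ℝ) ℓ))

/-- `p` is absolutely continuous on `[0, ℓ]` with derivative `q` (used below only for `q`
continuous on `[0, ℓ]` or square integrable on `(0, ℓ)`). -/
def IsPrimitiveOn (ℓ : ℝ) (p q : ℝ → ℂ) : Prop :=
  ∀ x ∈ Icc 0 ℓ, p x = p 0 + ∫ t in (0 : ℝ)..x, q t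

/-- `u ∈ W^{2,2}(0, ℓ)`: the element `u` of `L²(0, ℓ)` has the `C¹([0, ℓ])` representative `p`, with
derivative `q`, and `q` is absolutely continuous with derivative `g ∈ L²(0, ℓ)`.
So `p 0`, `p ℓ`, `q 0`, `q ℓ` are the boundary values of `u` and of `u'`, and `g = u''`. -/
structure IsW22 (ℓ : ℝ) (u : EdgeL2 ℓ) (p q : ℝ → ℂ) (g : EdgeL2 ℓ) : Prop where
  repr : u =ᵐ[volume.restrict (Ioo (0 : ℝ) ℓ)] p
  deriv : IsPrimitiveOn ℓ p q
  deriv_two : IsPrimitiveOn ℓ q g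

/-- `∂^{(τ)} u = (d/dx + iτ) u`, for a function `p` with derivative `q`. -/
def covDeriv (τ : ℝ) (p q : ℝ → ℂ) (x : ℝ) : ℂ := q x + Complex.I * τ * p x

/-- `(d/dx + iτ)² u`, for a function `p` with derivatives `q = p'` and `g = p''`. -/
def covDerivTwo (τ : ℝ) (p q g : ℝ → ℂ) (x : ℝ) : ℂ :=
  covDeriv τ q g x + Complex.I * τ * covDeriv τ p q x

/-- `f = -κ (d/dx + iτ)² u` in `L²(0, ℓ)`. -/
def IsEdgeAction (ℓ κ τ : ℝ) (p q : ℝ → ℂ) (g f : EdgeL2 ℓ) : Prop :=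
  f =ᵐ[volume.restrict (Ioo (0 : ℝ) ℓ)] fun x => -(κ : ℂ) * covDerivTwo τ p q g x

section helpers

theorem EdgeL2.intervalIntegrable {ℓ : ℝ} (g : EdgeL2 ℓ) {x : ℝ} (hx : x ∈ Icc 0 ℓ) :
    IntervalIntegrable g volume 0 x := by
  have h1 : IntegrableOn g (Ioo 0 ℓ) volume :=
    (Lp.memLp g).integrable (by norm_num)
  rw [intervalIntegrable_iff_integrableOn_Ioo_of_le hx.1]
  exact h1.mono_set (Ioo_subset_Ioo_right hx.2)

theorem IsPrimitiveOn.continuousOn {ℓ : ℝ} {p q : ℝ → ℂ} (h : IsPrimitiveOn ℓ p q)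
    (hq : ∀ x ∈ Icc 0 ℓ, IntervalIntegrable q volume 0 x) : ContinuousOn p (Icc 0 ℓ) := by
  rcases lt_or_ge ℓ 0 with hl | hl
  · simp [Icc_eq_empty (not_le.mpr hl)]
  have h1 : ContinuousOn (fun x => p 0 + ∫ t in (0 : ℝ)..x, q t) (Icc 0 ℓ) := by
    refine continuousOn_const.add ?_
    have := intervalIntegral.continuousOn_primitive_interval' (hq ℓ ⟨hl, le_rfl⟩)
      (left_mem_uIcc)
    rwa [uIcc_of_le hl] at this
  exact h1.congr h

theorem IsW22.continuousOn_snd {ℓ : ℝ} {u : EdgeL2 ℓ} {p q : ℝ → ℂ} {g : EdgeL2 ℓ}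
    (h : IsW22 ℓ u p q g) : ContinuousOn q (Icc 0 ℓ) :=
  h.deriv_two.continuousOn fun _ hx => g.intervalIntegrable hx

theorem IsW22.intervalIntegrable_snd {ℓ : ℝ} {u : EdgeL2 ℓ} {p q : ℝ → ℂ} {g : EdgeL2 ℓ}
    (h : IsW22 ℓ u p q g) {x : ℝ} (hx : x ∈ Icc 0 ℓ) : IntervalIntegrable q volume 0 x := by
  refine (h.continuousOn_snd.mono ?_).intervalIntegrable
  rw [uIcc_of_le hx.1]
  exact Icc_subset_Icc_right hx.2

theorem IsW22.continuousOn_fst {ℓ : ℝ} {u : EdgeL2 ℓ} {p q : ℝ → ℂ} {g : EdgeL2 ℓ}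
    (h : IsW22 ℓ u p q g) : ContinuousOn p (Icc 0 ℓ) :=
  h.deriv.continuousOn fun _ hx => h.intervalIntegrable_snd hx

theorem IsPrimitiveOn.add {ℓ : ℝ} {p q p' q' : ℝ → ℂ} (h : IsPrimitiveOn ℓ p q)
    (h' : IsPrimitiveOn ℓ p' q') (hq : ∀ x ∈ Icc 0 ℓ, IntervalIntegrable q volume 0 x)
    (hq' : ∀ x ∈ Icc 0 ℓ, IntervalIntegrable q' volume 0 x) :
    IsPrimitiveOn ℓ (p + p') (q + q') := by
  intro x hx
  simp only [Pi.add_apply]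
  rw [intervalIntegral.integral_add (hq x hx) (hq' x hx), h x hx, h' x hx]
  ring

theorem IsPrimitiveOn.smul {ℓ : ℝ} {p q : ℝ → ℂ} (h : IsPrimitiveOn ℓ p q) (c : ℂ) :
    IsPrimitiveOn ℓ (c • p) (c • q) := by
  intro x hx
  simp only [Pi.smul_apply, intervalIntegral.integral_smul]
  rw [h x hx, smul_add]

theorem IsPrimitiveOn.congr_ae {ℓ : ℝ} {p q q' : ℝ → ℂ} (h : IsPrimitiveOn ℓ p q)
    (hqq : q =ᵐ[volume.restrict (Ioo (0 : ℝ) ℓ)] q') : IsPrimitiveOn ℓ p q' := by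
  intro x hx
  rw [h x hx]
  congr 1
  rw [intervalIntegral.integral_of_le hx.1, intervalIntegral.integral_of_le hx.1,
    integral_Ioc_eq_integral_Ioo, integral_Ioc_eq_integral_Ioo]
  exact integral_congr_ae (ae_restrict_of_ae_restrict_of_subset (Ioo_subset_Ioo_right hx.2) hqq)

theorem IsW22.add {ℓ : ℝ} {u u' : EdgeL2 ℓ} {p q p' q' : ℝ → ℂ} {g g' : EdgeL2 ℓ}
    (h : IsW22 ℓ u p q g) (h' : IsW22 ℓ u' p' q' g') :
    IsW22 ℓ (u + u') (p + p') (q + q') (g + g') where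
  repr := (Lp.coeFn_add u u').trans (h.repr.add h'.repr)
  deriv := h.deriv.add h'.deriv (fun _ hx => h.intervalIntegrable_snd hx)
    (fun _ hx => h'.intervalIntegrable_snd hx)
  deriv_two := (h.deriv_two.add h'.deriv_two (fun _ hx => g.intervalIntegrable hx)
    (fun _ hx => g'.intervalIntegrable hx)).congr_ae (Lp.coeFn_add g g').symm

theorem IsW22.smul {ℓ : ℝ} {u : EdgeL2 ℓ} {p q : ℝ → ℂ} {g : EdgeL2 ℓ}
    (h : IsW22 ℓ u p q g) (c : ℂ) : IsW22 ℓ (c • u) (c • p) (c • q) (c • g) where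
  repr := (Lp.coeFn_smul c u).trans (h.repr.const_smul c)
  deriv := h.deriv.smul c
  deriv_two := (h.deriv_two.smul c).congr_ae (Lp.coeFn_smul c g).symm

theorem IsW22.zero (ℓ : ℝ) : IsW22 ℓ 0 0 0 0 := by
  have h := Lp.coeFn_zero ℂ 2 (volume.restrict (Ioo (0 : ℝ) ℓ))
  refine ⟨h, fun x _ => by simp, ?_⟩
  exact (show IsPrimitiveOn ℓ 0 0 from fun x _ => by simp).congr_ae h.symm

theorem IsEdgeAction.add {ℓ κ τ : ℝ} {p q p' q' : ℝ → ℂ} {g g' f f' : EdgeL2 ℓ}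
    (h : IsEdgeAction ℓ κ τ p q g f) (h' : IsEdgeAction ℓ κ τ p' q' g' f') :
    IsEdgeAction ℓ κ τ (p + p') (q + q') (g + g') (f + f') := by
  unfold IsEdgeAction at *
  filter_upwards [h, h', Lp.coeFn_add f f', Lp.coeFn_add g g'] with x h1 h2 h3 h4
  rw [h3, Pi.add_apply, h1, h2]
  simp only [covDerivTwo, covDeriv, Pi.add_apply, h4]
  ring

theorem IsEdgeAction.smul {ℓ κ τ : ℝ} {p q : ℝ → ℂ} {g f : EdgeL2 ℓ}
    (h : IsEdgeAction ℓ κ τ p q g f) (c : ℂ) :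
    IsEdgeAction ℓ κ τ (c • p) (c • q) (c • g) (c • f) := by
  unfold IsEdgeAction at *
  filter_upwards [h, Lp.coeFn_smul c f, Lp.coeFn_smul c g] with x h1 h3 h4
  rw [h3, Pi.smul_apply, h1]
  simp only [covDerivTwo, covDeriv, Pi.smul_apply, h4, smul_eq_mul]
  ring

theorem IsEdgeAction.zero (ℓ κ τ : ℝ) : IsEdgeAction ℓ κ τ 0 0 0 0 := by
  unfold IsEdgeAction
  filter_upwards [Lp.coeFn_zero ℂ 2 (volume.restrict (Ioo (0 : ℝ) ℓ))] with x h
  simp only [h, covDerivTwo, covDeriv, Pi.zero_apply, mul_zero, add_zero]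

/-- The representatives are determined by the function. -/
theorem IsW22.eq_zero {ℓ : ℝ} (hℓ : 0 < ℓ) {p q : ℝ → ℂ} {g : EdgeL2 ℓ}
    (h : IsW22 ℓ 0 p q g) :
    (∀ x ∈ Icc 0 ℓ, p x = 0) ∧ (∀ x ∈ Icc 0 ℓ, q x = 0) ∧ g = 0 := by
  have aux : ∀ P Q : ℝ → ℂ, IsPrimitiveOn ℓ P Q → (∀ x ∈ Icc 0 ℓ, P x = 0) →
      IntervalIntegrable Q volume 0 ℓ → Q =ᵐ[volume.restrict (Ioo (0 : ℝ) ℓ)] 0 := by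
    intro P Q hPQ hP hQ
    have hQi : IntegrableOn Q (Ioo 0 ℓ) volume := by
      rwa [intervalIntegrable_iff_integrableOn_Ioo_of_le hℓ.le] at hQ
    have hd := hQ.ae_hasDerivAt_integral
    rw [Filter.EventuallyEq, ae_restrict_iff' measurableSet_Ioo]
    filter_upwards [hd] with x hx hxm
    have hx' := hx (by rw [uIcc_of_le hℓ.le]; exact Ioo_subset_Icc_self hxm) 0 left_mem_uIcc
    have hz : (fun y => ∫ t in (0 : ℝ)..y, Q t) =ᶠ[nhds x] fun _ => (0 : ℂ) := by
      filter_upwards [isOpen_Ioo.mem_nhds hxm] with y hy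
      have h1 := hPQ y (Ioo_subset_Icc_self hy)
      rw [hP y (Ioo_subset_Icc_self hy), hP 0 ⟨le_rfl, hℓ.le⟩, zero_add] at h1
      exact h1.symm
    exact (hx'.congr_of_eventuallyEq hz.symm).unique (hasDerivAt_const x (0 : ℂ))
  have ext : ∀ P : ℝ → ℂ, ContinuousOn P (Icc 0 ℓ) →
      P =ᵐ[volume.restrict (Ioo (0 : ℝ) ℓ)] 0 → ∀ x ∈ Icc 0 ℓ, P x = 0 := by
    intro P hc hP
    have h1 : EqOn P 0 (Ioo 0 ℓ) :=
      Measure.eqOn_open_of_ae_eq hP isOpen_Ioo (hc.mono Ioo_subset_Icc_self) continuousOn_const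
    have h2 : EqOn P 0 (closure (Ioo 0 ℓ)) := by
      refine h1.of_subset_closure ?_ continuousOn_const subset_closure le_rfl
      rwa [closure_Ioo hℓ.ne]
    rw [closure_Ioo hℓ.ne] at h2
    exact h2
  have hℓm : ℓ ∈ Icc 0 ℓ := ⟨hℓ.le, le_rfl⟩
  have hp := ext p h.continuousOn_fst
    (h.repr.symm.trans (Lp.coeFn_zero ℂ 2 (volume.restrict (Ioo (0 : ℝ) ℓ))))
  have hq := ext q h.continuousOn_snd (aux p q h.deriv hp (h.intervalIntegrable_snd hℓm))
  refine ⟨hp, hq, ?_⟩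
  refine Lp.ext ?_
  exact (aux q g h.deriv_two hq (g.intervalIntegrable hℓm)).trans
    (Lp.coeFn_zero ℂ 2 (volume.restrict (Ioo (0 : ℝ) ℓ))).symm

theorem IsEdgeAction.eq_zero {ℓ : ℝ} (hℓ : 0 < ℓ) {κ τ : ℝ} {p q : ℝ → ℂ} {g f : EdgeL2 ℓ}
    (h : IsW22 ℓ 0 p q g) (hf : IsEdgeAction ℓ κ τ p q g f) : f = 0 := by
  obtain ⟨hp, hq, rfl⟩ := h.eq_zero hℓ
  refine Lp.ext ?_
  unfold IsEdgeAction at hf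
  filter_upwards [hf, Lp.coeFn_zero ℂ 2 (volume.restrict (Ioo (0 : ℝ) ℓ)),
    ae_restrict_mem measurableSet_Ioo] with x h1 h2 h3
  simp only [h1, h2, covDerivTwo, covDeriv, Pi.zero_apply, mul_zero, add_zero,
    hp x (Ioo_subset_Icc_self h3), hq x (Ioo_subset_Icc_self h3)]

end helpers

/-! ### High-contrast weighted graphs and their fibre operators -/

/-- A finite metric graph with oriented edges `e ≅ [0, len e]`, with edge coefficients `a_e`, with a
set of soft edges (the other edges are stiff), and with vertex weights depending on the
quasimomentum `τ`: `wLeft τ e` and `wRight τ e` are the weights `w_V(e)` at the vertices `V` that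
are the left and the right endpoint of `e`. -/
structure HighContrastGraph (V E : Type) where
  left : E → V
  right : E → V
  len : E → ℝ
  coeff : E → ℝ
  soft : Finset E
  wLeft : ℝ → E → ℂ
  wRight : ℝ → E → ℂ

namespace HighContrastGraph

variable {V E : Type} [Fintype E] [DecidableEq V] [DecidableEq E]

/-- `L²(𝔾)`, the orthogonal sum of the spaces `L²(0, len e)`. -/
abbrev L2 (G : HighContrastGraph V E) : Type := PiLp 2 fun e : E => EdgeL2 (G.len e)

/-- The number `a_e(ε)² / ε²`, where `a_e(ε) = a_e ε` on soft edges and `a_e(ε) = a_e` on stiff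
edges. -/
def kappa (G : HighContrastGraph V E) (ε : ℝ) (e : E) : ℝ :=
  (if e ∈ G.soft then G.coeff e * ε else G.coeff e) ^ 2 / ε ^ 2

/-- The weighted continuity condition: at every vertex `V` there is a common value
`c V = w_V(e) u_e(V)` for all edge ends at `V`. -/
def WeightedContinuity (G : HighContrastGraph V E) (τ : ℝ) (p : E → ℝ → ℂ) : Prop :=
  ∃ c : V → ℂ, ∀ e, G.wLeft τ e * p e 0 = c (G.left e) ∧
    G.wRight τ e * p e (G.len e) = c (G.right e)

/-- The sum over the edge ends at `v` of the weighted inward normal co-derivatives. -/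
def normalSum (G : HighContrastGraph V E) (ε τ : ℝ) (p q : E → ℝ → ℂ) (v : V) : ℂ :=
  ∑ e, ((if G.left e = v then G.wLeft τ e * G.kappa ε e * covDeriv τ (p e) (q e) 0 else 0) +
    (if G.right e = v then
      -(G.wRight τ e * G.kappa ε e * covDeriv τ (p e) (q e) (G.len e)) else 0))

/-- The graph of the fibre operator `A_ε^{(τ)}`: pairs `(u, f)` with `u_e ∈ W^{2,2}(0, len e)`
satisfying at every vertex weighted continuity and the weighted Kirchhoff condition, and
`f_e = -(a_e(ε)² / ε²) (d/dx + iτ)² u_e`. -/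
def fibreGraph (G : HighContrastGraph V E) (ε τ : ℝ) : Submodule ℂ (G.L2 × G.L2) where
  carrier := {x | ∃ (p q : E → ℝ → ℂ) (g : G.L2),
    (∀ e, IsW22 (G.len e) (x.1 e) (p e) (q e) (g e)) ∧
    G.WeightedContinuity τ p ∧
    (∀ v, G.normalSum ε τ p q v = 0) ∧
    ∀ e, IsEdgeAction (G.len e) (G.kappa ε e) τ (p e) (q e) (g e) (x.2 e)}
  add_mem' := by
    rintro x y ⟨p, q, g, hW, ⟨c, hc⟩, hK, hA⟩ ⟨p', q', g', hW', ⟨c', hc'⟩, hK', hA'⟩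
    refine ⟨p + p', q + q', g + g', fun e => (hW e).add (hW' e), ⟨c + c', fun e => ?_⟩,
      fun v => ?_, fun e => (hA e).add (hA' e)⟩
    · simp only [Pi.add_apply, mul_add, (hc e).1, (hc e).2, (hc' e).1, (hc' e).2, and_self]
    · have h : G.normalSum ε τ (p + p') (q + q') v
          = G.normalSum ε τ p q v + G.normalSum ε τ p' q' v := ?_
      · rw [h, hK v, hK' v, add_zero]
      simp only [normalSum, ← Finset.sum_add_distrib, covDeriv, Pi.add_apply]
      refine Finset.sum_congr rfl fun e _ => ?_
      split_ifs <;> ring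
  zero_mem' := by
    refine ⟨0, 0, 0, fun e => IsW22.zero _, ⟨0, fun e => by simp⟩, fun v => ?_,
      fun e => IsEdgeAction.zero _ _ _⟩
    simp [normalSum, covDeriv]
  smul_mem' := by
    rintro k x ⟨p, q, g, hW, ⟨c, hc⟩, hK, hA⟩
    refine ⟨k • p, k • q, k • g, fun e => (hW e).smul k, ⟨k • c, fun e => ?_⟩,
      fun v => ?_, fun e => (hA e).smul k⟩
    · simp only [Pi.smul_apply, smul_eq_mul, ← (hc e).1, ← (hc e).2]
      constructor <;> ring
    · rw [← mul_zero k, ← hK v]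
      simp only [normalSum, Finset.mul_sum, covDeriv, Pi.smul_apply, smul_eq_mul]
      refine Finset.sum_congr rfl fun e _ => ?_
      split_ifs <;> ring

/-- The fibre operator `A_ε^{(τ)}` in `L²(𝔾)`. -/
def fibreOp (G : HighContrastGraph V E) (ε τ : ℝ) : G.L2 →ₗ.[ℂ] G.L2 :=
  (G.fibreGraph ε τ).toLinearPMap

theorem fibreOp_graph (G : HighContrastGraph V E) (hlen : ∀ e, 0 < G.len e) (ε τ : ℝ) :
    (G.fibreOp ε τ).graph = G.fibreGraph ε τ := by
  refine Submodule.toLinearPMap_graph_eq _ ?_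
  rintro ⟨u, f⟩ ⟨p, q, g, hW, -, -, hA⟩ rfl
  ext1 e
  exact IsEdgeAction.eq_zero (hlen e) (hW e) (hA e)

end HighContrastGraph

/-! ### The graph with a connected soft and a disconnected stiff component -/

/-- Two vertices, `0` for `V₁` and `1` for `V₂`, and three edges, `j - 1` for `e^{(j)}`. The edges
`e^{(1)}` (from `V₂` to `V₁`) and `e^{(2)}` (from `V₁` to `V₂`) are soft, the edge `e^{(3)}`
(from `V₂` to `V₁`) is stiff. The weights are `1, 1, e^{iτ(l₂ + l₃)}` at `V₁` and
`e^{iτ l₃}, 1, 1` at `V₂`. -/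
def softConnectedGraph (l a : Fin 3 → ℝ) : HighContrastGraph (Fin 2) (Fin 3) where
  left := ![1, 0, 1]
  right := ![0, 1, 0]
  len := l
  coeff := a
  soft := {0, 1}
  wLeft := fun τ => ![Complex.exp (Complex.I * τ * l 2), 1, 1]
  wRight := fun τ => ![1, 1, Complex.exp (Complex.I * τ * (l 1 + l 2))]

/-- `H_hom = L²(0, l₁) ⊕ L²(0, l₂) ⊕ ℂ`. -/
abbrev HomSpace (l : Fin 3 → ℝ) : Type :=
  WithLp 2 (EdgeL2 (l 0) × WithLp 2 (EdgeL2 (l 1) × ℂ))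

/-- `ξ₁^{(τ)} = exp(-iτ(l₂ + l₃))`. -/
def xiOne (l : Fin 3 → ℝ) (τ : ℝ) : ℂ := Complex.exp (-(Complex.I * τ * (l 1 + l 2)))

/-- `ξ₂^{(τ)} = exp(-iτ l₂)`. -/
def xiTwo (l : Fin 3 → ℝ) (τ : ℝ) : ℂ := Complex.exp (-(Complex.I * τ * l 1))

open ComplexConjugate in
/-- The combination of boundary values of the co-derivatives in the third component of the
homogenised operator. -/
def homFlux (l a : Fin 3 → ℝ) (τ : ℝ) (p₁ q₁ p₂ q₂ : ℝ → ℂ) : ℂ :=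
  (a 1 : ℂ) ^ 2 * covDeriv τ p₂ q₂ 0
    - (a 1 : ℂ) ^ 2 * conj (xiTwo l τ) * covDeriv τ p₂ q₂ (l 1)
    + (a 0 : ℂ) ^ 2 * conj (xiOne l τ) * covDeriv τ p₁ q₁ 0
    - (a 0 : ℂ) ^ 2 * covDeriv τ p₁ q₁ (l 0)

open ComplexConjugate in
/-- The graph of the homogenised operator: pairs `((u₁, u₂, β), (f₁, f₂, δ))` with
`u_j ∈ W^{2,2}(0, l_j)`,
`u₂(0) = conj ξ₂ u₂(l₂) = conj ξ₁ u₁(0) = u₁(l₁) = β / √l₃`,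
`f_j = -a_j² (d/dx + iτ)² u_j = a_j² (-i d/dx + τ)² u_j`, and `δ = -(1/√l₃)` times the flux. -/
def homGraph (l a : Fin 3 → ℝ) (τ : ℝ) : Submodule ℂ (HomSpace l × HomSpace l) where
  carrier := {x | ∃ (p₁ q₁ p₂ q₂ : ℝ → ℂ) (g₁ : EdgeL2 (l 0)) (g₂ : EdgeL2 (l 1)),
    IsW22 (l 0) x.1.fst p₁ q₁ g₁ ∧ IsW22 (l 1) x.1.snd.fst p₂ q₂ g₂ ∧
    (p₂ 0 = x.1.snd.snd / (√(l 2) : ℝ) ∧ conj (xiTwo l τ) * p₂ (l 1) = x.1.snd.snd / (√(l 2) : ℝ) ∧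
      conj (xiOne l τ) * p₁ 0 = x.1.snd.snd / (√(l 2) : ℝ) ∧
      p₁ (l 0) = x.1.snd.snd / (√(l 2) : ℝ)) ∧
    IsEdgeAction (l 0) (a 0 ^ 2) τ p₁ q₁ g₁ x.2.fst ∧
    IsEdgeAction (l 1) (a 1 ^ 2) τ p₂ q₂ g₂ x.2.snd.fst ∧
    x.2.snd.snd = -(1 / (√(l 2) : ℝ)) * homFlux l a τ p₁ q₁ p₂ q₂}
  add_mem' := by
    rintro x y ⟨p, q, r, s, g, h, hW, hV, ⟨h1, h2, h3, h4⟩, hA, hB, hF⟩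
      ⟨p', q', r', s', g', h', hW', hV', ⟨h1', h2', h3', h4'⟩, hA', hB', hF'⟩
    refine ⟨p + p', q + q', r + r', s + s', g + g', h + h', hW.add hW', hV.add hV',
      ⟨?_, ?_, ?_, ?_⟩, hA.add hA', hB.add hB', ?_⟩
    · simp [h1, h1', add_div]
    · simp [h2, h2', add_div, mul_add]
    · simp [h3, h3', add_div, mul_add]
    · simp [h4, h4', add_div]
    · simp only [Prod.snd_add, WithLp.add_snd, hF, hF', homFlux, covDeriv, Pi.add_apply]
      ring
  zero_mem' := by
    refine ⟨0, 0, 0, 0, 0, 0, IsW22.zero _, IsW22.zero _, ⟨?_, ?_, ?_, ?_⟩,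
      IsEdgeAction.zero _ _ _, IsEdgeAction.zero _ _ _, ?_⟩ <;> simp [homFlux, covDeriv]
  smul_mem' := by
    rintro k x ⟨p, q, r, s, g, h, hW, hV, ⟨h1, h2, h3, h4⟩, hA, hB, hF⟩
    refine ⟨k • p, k • q, k • r, k • s, k • g, k • h, hW.smul k, hV.smul k,
      ⟨?_, ?_, ?_, ?_⟩, hA.smul k, hB.smul k, ?_⟩
    · simp [h1, mul_div_assoc]
    · simp [mul_div_assoc, ← h2]; ring
    · simp [mul_div_assoc, ← h3]; ring
    · simp [h4, mul_div_assoc]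
    · change k • x.2.snd.snd = _
      simp only [hF, homFlux, covDeriv, Pi.smul_apply, smul_eq_mul]
      ring

/-- The homogenised operator `𝒜_hom^{(τ)}` in `H_hom`. -/
def homOp (l a : Fin 3 → ℝ) (τ : ℝ) : HomSpace l →ₗ.[ℂ] HomSpace l :=
  (homGraph l a τ).toLinearPMap

theorem homOp_graph (l a : Fin 3 → ℝ) (hl : ∀ j, 0 < l j) (τ : ℝ) :
    (homOp l a τ).graph = homGraph l a τ := by
  refine Submodule.toLinearPMap_graph_eq _ ?_
  rintro ⟨u, f⟩ ⟨p, q, r, s, g, h, hW, hV, -, hA, hB, hF⟩ rfl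
  have hz : ∀ j, (0 : ℝ) ∈ Icc 0 (l j) := fun j => ⟨le_rfl, (hl j).le⟩
  have he : ∀ j, l j ∈ Icc 0 (l j) := fun j => ⟨(hl j).le, le_rfl⟩
  have e1 := hW.eq_zero (hl 0)
  have e2 := hV.eq_zero (hl 1)
  have f1 := IsEdgeAction.eq_zero (hl 0) hW hA
  have f2 := IsEdgeAction.eq_zero (hl 1) hV hB
  have f3 : f.snd.snd = 0 := by
    rw [hF]
    simp [homFlux, covDeriv, e1.1 _ (hz 0), e1.1 _ (he 0), e1.2.1 _ (hz 0), e1.2.1 _ (he 0),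
      e2.1 _ (hz 1), e2.1 _ (he 1), e2.2.1 _ (hz 1), e2.2.1 _ (he 1)]
  refine WithLp.ofLp_injective 2 (Prod.ext f1 (WithLp.ofLp_injective 2 (Prod.ext f2 f3)))

/-! ### The partial isometry -/

/-- The function `x ↦ l₃^{-1/2} e^{-iτ(l₂ + x)}` on the stiff edge: the normalised solution of
`(d/dx + iτ) u = 0` whose value at `V₂` is `l₃^{-1/2} ξ₂^{(τ)}`. -/
def stiffMode (l : Fin 3 → ℝ) (τ : ℝ) (x : ℝ) : ℂ :=
  Complex.exp (-(Complex.I * τ * (l 1 + x))) / (√(l 2) : ℝ)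

theorem memLp_stiffMode (l : Fin 3 → ℝ) (τ : ℝ) :
    MemLp (stiffMode l τ) 2 (volume.restrict (Ioo (0 : ℝ) (l 2))) := by
  have hc : Continuous (stiffMode l τ) := by
    unfold stiffMode
    fun_prop
  refine MemLp.of_bound hc.aestronglyMeasurable (1 / √(l 2)) (Filter.Eventually.of_forall ?_)
  intro x
  have : -(Complex.I * τ * (l 1 + x)) = ((-(τ * (l 1 + x)) : ℝ) : ℂ) * Complex.I := by
    push_cast; ring
  rw [stiffMode, this, norm_div, Complex.norm_exp_ofReal_mul_I, Complex.norm_real,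
    Real.norm_of_nonneg (Real.sqrt_nonneg _)]

/-- `Ψ (u₁, u₂, u₃) = (u₁, u₂, ⟨u₃, ψ⟩)`, where `ψ` is the stiff mode, that is,
`⟨u₃, ψ⟩ = l₃^{-1/2} ∫₀^{l₃} e^{iτ(l₂ + x)} u₃(x) dx`. -/
def Psi (l a : Fin 3 → ℝ) (τ : ℝ) : (softConnectedGraph l a).L2 →L[ℂ] HomSpace l :=
  (WithLp.prodContinuousLinearEquiv 2 ℂ _ _).symm.toContinuousLinearMap ∘L
    (PiLp.proj 2 (fun e : Fin 3 => EdgeL2 (l e)) 0).prod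
      ((WithLp.prodContinuousLinearEquiv 2 ℂ _ _).symm.toContinuousLinearMap ∘L
        (PiLp.proj 2 (fun e : Fin 3 => EdgeL2 (l e)) 1).prod
          (innerSL ℂ ((memLp_stiffMode l τ).toLp (stiffMode l τ)) ∘L
            PiLp.proj 2 (fun e : Fin 3 => EdgeL2 (l e)) 2))

/-! ### Operator-theoretic notions -/

section operators

variable {H H' : Type*} [NormedAddCommGroup H] [InnerProductSpace ℂ H]
  [NormedAddCommGroup H'] [InnerProductSpace ℂ H']

/-- A partial isometry is isometric on the orthogonal complement of its kernel. -/
def IsPartialIsometry (T : H →L[ℂ] H') : Prop :=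
  ∀ x ∈ (LinearMap.ker T.toLinearMap)ᗮ, ‖T x‖ = ‖x‖

/-- The bounded operator `R` is the resolvent `(A - z)⁻¹` of the unbounded operator `A`: it maps
into the domain of `A` and is a right and left inverse of `A - z`. -/
def IsResolventAt (A : H →ₗ.[ℂ] H) (z : ℂ) (R : H →L[ℂ] H) : Prop :=
  (∀ f : H, ∃ h : R f ∈ A.domain, A ⟨R f, h⟩ - z • R f = f) ∧
    ∀ u : A.domain, R (A u - z • (u : H)) = u

end operators

end

/-! The resolvent difference is estimated weakly, through `⟨w, (R - Ψ* R₀ Ψ) f⟩`. Let `(u, F)` lie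
in the graph of the fibre operator with `F - z̄ u = w`, and let `x` lie in the graph of the
homogenised operator with `x.2 - z x.1 = Ψ f`. Extending `x.1` to the stiff edge by its third
component times the stiff mode `ψ` gives `Ψ* x.1`. This function satisfies the weighted continuity
conditions, but of the two Kirchhoff conditions only one combination is under control. Green's
formula on the whole graph (`IsContinuousSol.green`) then yields the exact identity
`inner_sub_inner_graphTriple`: the form is the sum of two products. One pairs the deviation of `u₃`
from a multiple of `ψ` with a bounded function; the other pairs the mismatch `c₀ - ξ̄₂ c₁` of the
vertex values of `u` with a bounded flux.

The first factors are `O(ε²)` (`exists_stiff_edge_estimate`). Soft co-derivatives are bounded by the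
graph norm, so the Kirchhoff condition at `V₂` bounds `κ₃ ∂u₃` there. Along the edge `e^{iτx} ∂u₃`
varies by `O(‖f₃‖/κ₃)`, where `f₃` is the stiff component of `F`. Since `κ₃ = a₃²/ε²`, all of `∂u₃`
is `O(ε²)`, and `u₃` almost solves `∂u₃ = 0`. All constants are uniform in `τ` because the gauge
factor `e^{iτx}` has modulus one.

Resolvents exist because both operators are symmetric and `A - z` is onto: each edge equation is
solvable with arbitrary Cauchy data, and the boundary conditions form a square linear system that is
injective by symmetry when `Im z ≠ 0`. Surjectivity at `z` and `z̄` also gives self-adjointness. -/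

open ComplexConjugate

/-! ### Calculus of absolutely continuous functions and Green's formula on an edge. -/

theorem absolutelyContinuousOnInterval_integral {a b : ℝ} {f : ℝ → ℂ}
    (hf : IntervalIntegrable f volume a b) :
    AbsolutelyContinuousOnInterval (fun x => ∫ t in a..x, f t) a b := by
  have h := hf.norm.absolutelyContinuousOnInterval_intervalIntegral left_mem_uIcc
  rw [absolutelyContinuousOnInterval_iff] at h ⊢
  intro ε hε
  obtain ⟨δ, hδ, H⟩ := h ε hε
  -- Each increment of the primitive of `f` is dominated by that of the primitive of `‖f‖`, so the
  -- same `δ` serves.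
  refine ⟨δ, hδ, fun E hE hs => (Finset.sum_le_sum fun i hi => ?_).trans_lt (H E hE hs)⟩
  have hm := hE.1 i hi
  have hi' : ∀ x ∈ uIcc a b, IntervalIntegrable f volume a x := fun x hx =>
    hf.mono_set (uIcc_subset_uIcc left_mem_uIcc hx)
  rw [dist_comm, dist_comm (∫ t in a..(E.2 i).1, ‖f t‖), dist_eq_norm, dist_eq_norm,
    intervalIntegral.integral_interval_sub_left (hi' _ hm.2) (hi' _ hm.1),
    intervalIntegral.integral_interval_sub_left (hi' _ hm.2).norm (hi' _ hm.1).norm]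
  exact intervalIntegral.norm_integral_le_abs_integral_norm

/-- The derivatives are only integrable, so the product rule holds only almost everywhere. The
product minus the primitive of the expected derivative is absolutely continuous with derivative zero
a.e., hence constant. -/
theorem IsPrimitiveOn.mul {ℓ : ℝ} (hℓ : 0 ≤ ℓ) {p q p' q' : ℝ → ℂ} (h : IsPrimitiveOn ℓ p q)
    (h' : IsPrimitiveOn ℓ p' q') (hq : IntervalIntegrable q volume 0 ℓ)
    (hq' : IntervalIntegrable q' volume 0 ℓ) :
    IsPrimitiveOn ℓ (fun x => p x * p' x) (fun x => q x * p' x + p x * q' x) := by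
  have hsub : ∀ x ∈ Icc 0 ℓ, uIcc 0 x ⊆ uIcc 0 ℓ := fun x hx => by
    rw [uIcc_of_le hx.1, uIcc_of_le hℓ]; exact Icc_subset_Icc_right hx.2
  have hc : ContinuousOn p (uIcc 0 ℓ) := by
    rw [uIcc_of_le hℓ]; exact h.continuousOn fun x hx => hq.mono_set (hsub x hx)
  have hc' : ContinuousOn p' (uIcc 0 ℓ) := by
    rw [uIcc_of_le hℓ]; exact h'.continuousOn fun x hx => hq'.mono_set (hsub x hx)
  have hr : IntervalIntegrable (fun x => q x * p' x + p x * q' x) volume 0 ℓ :=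
    (hq.mul_continuousOn hc').add (hq'.continuousOn_mul hc)
  have hconst : ∀ c : ℂ, AbsolutelyContinuousOnInterval (fun _ : ℝ => c) 0 ℓ := fun c =>
    ContDiffOn.absolutelyContinuousOnInterval contDiffOn_const
  have hac1 : AbsolutelyContinuousOnInterval (fun x => p 0 + ∫ t in (0 : ℝ)..x, q t) 0 ℓ :=
    (hconst _).fun_add (absolutelyContinuousOnInterval_integral hq)
  have hac2 : AbsolutelyContinuousOnInterval (fun x => p' 0 + ∫ t in (0 : ℝ)..x, q' t) 0 ℓ :=
    (hconst _).fun_add (absolutelyContinuousOnInterval_integral hq')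
  have hac3 := absolutelyContinuousOnInterval_integral hr
  have hac := (hac1.fun_smul hac2).fun_sub hac3
  obtain ⟨C, hC⟩ := hac.const_of_ae_hasDerivAt_zero (by
    filter_upwards [hq.ae_hasDerivAt_integral, hq'.ae_hasDerivAt_integral,
      hr.ae_hasDerivAt_integral] with x h1 h2 h3 hx
    have hx' := hx
    rw [uIcc_of_le hℓ] at hx'
    have e1 := ((h1 hx 0 left_mem_uIcc).const_add (p 0)).smul
      ((h2 hx 0 left_mem_uIcc).const_add (p' 0))
    refine (e1.fun_sub (h3 hx 0 left_mem_uIcc)).congr_deriv ?_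
    simp only [smul_eq_mul, ← h x hx', ← h' x hx']
    ring)
  intro x hx
  have hx' := hx
  rw [← uIcc_of_le hℓ] at hx'
  have e1 := hC x hx'
  have e2 := hC 0 left_mem_uIcc
  simp only [smul_eq_mul, ← h x hx, ← h' x hx, intervalIntegral.integral_same, add_zero,
    sub_zero] at e1 e2
  dsimp only
  linear_combination e1 - e2

theorem IsPrimitiveOn.conj {ℓ : ℝ} {p q : ℝ → ℂ} (h : IsPrimitiveOn ℓ p q) :
    IsPrimitiveOn ℓ (fun x => conj (p x)) (fun x => conj (q x)) := by
  intro x hx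
  simp only [h x hx, map_add, intervalIntegral.integral_of_le hx.1, integral_conj]

theorem IsPrimitiveOn.congr {ℓ : ℝ} {p q q' : ℝ → ℂ} (h : IsPrimitiveOn ℓ p q)
    (hqq : ∀ x ∈ Icc 0 ℓ, q x = q' x) : IsPrimitiveOn ℓ p q' := by
  refine h.congr_ae ?_
  filter_upwards [ae_restrict_mem measurableSet_Ioo] with x hx
  exact hqq x (Ioo_subset_Icc_self hx)

theorem IsPrimitiveOn.of_hasDerivAt {ℓ : ℝ} {p q : ℝ → ℂ} (h : ∀ x, HasDerivAt p (q x) x)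
    (hq : Continuous q) : IsPrimitiveOn ℓ p q := by
  intro x _
  rw [intervalIntegral.integral_eq_sub_of_hasDerivAt (fun t _ => h t) (hq.intervalIntegrable _ _)]
  ring

theorem intervalIntegrable_conj {a b : ℝ} {f : ℝ → ℂ} (hf : IntervalIntegrable f volume a b) :
    IntervalIntegrable (fun x => conj (f x)) volume a b :=
  ⟨(RCLike.conjLIE (K := ℂ)).integrable_comp_iff.2 hf.1,
    (RCLike.conjLIE (K := ℂ)).integrable_comp_iff.2 hf.2⟩

theorem EdgeL2.inner_eq_intervalIntegral {ℓ : ℝ} (hℓ : 0 ≤ ℓ) {u v : EdgeL2 ℓ} {p r : ℝ → ℂ}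
    (hu : u =ᵐ[volume.restrict (Ioo (0 : ℝ) ℓ)] p) (hv : v =ᵐ[volume.restrict (Ioo (0 : ℝ) ℓ)] r) :
    inner ℂ u v = ∫ x in (0 : ℝ)..ℓ, conj (p x) * r x := by
  rw [L2.inner_def, intervalIntegral.integral_of_le hℓ, integral_Ioc_eq_integral_Ioo]
  refine integral_congr_ae ?_
  filter_upwards [hu, hv] with x h1 h2
  rw [h1, h2, RCLike.inner_apply, mul_comm]

section edge

variable {ℓ κ τ : ℝ} {u f : EdgeL2 ℓ} {p q : ℝ → ℂ} {g : EdgeL2 ℓ}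

theorem IsW22.covDeriv_isPrimitiveOn (h : IsW22 ℓ u p q g) :
    IsPrimitiveOn ℓ (covDeriv τ p q) (covDeriv τ q g) := by
  have h1 := h.deriv_two.add (h.deriv.smul (Complex.I * τ))
    (fun x hx => g.intervalIntegrable hx) (fun x hx => (h.intervalIntegrable_snd hx).const_mul _)
  exact h1

theorem IsW22.intervalIntegrable_covDeriv_snd (h : IsW22 ℓ u p q g) (hℓ : 0 ≤ ℓ) :
    IntervalIntegrable (covDeriv τ q g) volume 0 ℓ :=
  (g.intervalIntegrable ⟨hℓ, le_rfl⟩).add ((h.intervalIntegrable_snd ⟨hℓ, le_rfl⟩).const_mul _)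

/-- Green's formula on an edge. -/
theorem IsW22.green (hℓ : 0 ≤ ℓ) (h : IsW22 ℓ u p q g) (hf : IsEdgeAction ℓ κ τ p q g f)
    {u' f' : EdgeL2 ℓ} {p' q' : ℝ → ℂ} {g' : EdgeL2 ℓ}
    (h' : IsW22 ℓ u' p' q' g') (hf' : IsEdgeAction ℓ κ τ p' q' g' f') :
    inner ℂ f u' - inner ℂ u f' = κ * (conj (covDeriv τ p q 0) * p' 0
      - conj (covDeriv τ p q ℓ) * p' ℓ - conj (p 0) * covDeriv τ p' q' 0
      + conj (p ℓ) * covDeriv τ p' q' ℓ) := by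
  have hm : ℓ ∈ Icc 0 ℓ := ⟨hℓ, le_rfl⟩
  have e1 := (h.covDeriv_isPrimitiveOn (τ := τ)).conj.mul hℓ h'.deriv
    (intervalIntegrable_conj (h.intervalIntegrable_covDeriv_snd hℓ)) (h'.intervalIntegrable_snd hm)
  have e2 := h.deriv.conj.mul hℓ (h'.covDeriv_isPrimitiveOn (τ := τ))
    (intervalIntegrable_conj (h.intervalIntegrable_snd hm)) (h'.intervalIntegrable_covDeriv_snd hℓ)
  have hcp : ContinuousOn p (uIcc 0 ℓ) := by rw [uIcc_of_le hℓ]; exact h.continuousOn_fst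
  have hcq : ContinuousOn q (uIcc 0 ℓ) := by rw [uIcc_of_le hℓ]; exact h.continuousOn_snd
  have hcp' : ContinuousOn p' (uIcc 0 ℓ) := by rw [uIcc_of_le hℓ]; exact h'.continuousOn_fst
  have hcq' : ContinuousOn q' (uIcc 0 ℓ) := by rw [uIcc_of_le hℓ]; exact h'.continuousOn_snd
  have hcD : ContinuousOn (covDeriv τ p q) (uIcc 0 ℓ) := hcq.add (hcp.const_mul _)
  have hcD' : ContinuousOn (covDeriv τ p' q') (uIcc 0 ℓ) := hcq'.add (hcp'.const_mul _)
  have hD2 : IntervalIntegrable (covDerivTwo τ p q g) volume 0 ℓ :=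
    (h.intervalIntegrable_covDeriv_snd hℓ).add (hcD.const_mul _).intervalIntegrable
  have hD2' : IntervalIntegrable (covDerivTwo τ p' q' g') volume 0 ℓ :=
    (h'.intervalIntegrable_covDeriv_snd hℓ).add (hcD'.const_mul _).intervalIntegrable
  have i1 : IntervalIntegrable (fun x => conj (covDerivTwo τ p q g x) * p' x) volume 0 ℓ :=
    (intervalIntegrable_conj hD2).mul_continuousOn hcp'
  have i2 : IntervalIntegrable (fun x => conj (p x) * covDerivTwo τ p' q' g' x) volume 0 ℓ :=
    hD2'.continuousOn_mul (Complex.continuous_conj.comp_continuousOn hcp)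
  have i3 : IntervalIntegrable (fun x => conj (covDeriv τ q g x) * p' x
      + conj (covDeriv τ p q x) * q' x) volume 0 ℓ :=
    ((intervalIntegrable_conj (h.intervalIntegrable_covDeriv_snd hℓ)).mul_continuousOn hcp').add
      ((Complex.continuous_conj.comp_continuousOn hcD).mul hcq').intervalIntegrable
  have i4 : IntervalIntegrable (fun x => conj (q x) * covDeriv τ p' q' x
      + conj (p x) * covDeriv τ q' g' x) volume 0 ℓ :=
    ((Complex.continuous_conj.comp_continuousOn hcq).mul hcD').intervalIntegrable.add
      ((h'.intervalIntegrable_covDeriv_snd hℓ).continuousOn_mul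
        (Complex.continuous_conj.comp_continuousOn hcp))
  rw [EdgeL2.inner_eq_intervalIntegral hℓ hf h'.repr, EdgeL2.inner_eq_intervalIntegral hℓ h.repr hf']
  have e3 := e1 ℓ hm
  have e4 := e2 ℓ hm
  simp only at e3 e4
  -- The integrands differ by the first-order terms only; since `iτ` is purely imaginary, these
  -- cancel in the difference and both integrands become derivatives of products.
  have key : (∫ x in (0 : ℝ)..ℓ, conj (covDerivTwo τ p q g x) * p' x)
      - ∫ x in (0 : ℝ)..ℓ, conj (p x) * covDerivTwo τ p' q' g' x
      = (∫ x in (0 : ℝ)..ℓ, conj (covDeriv τ q g x) * p' x + conj (covDeriv τ p q x) * q' x)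
      - ∫ x in (0 : ℝ)..ℓ, conj (q x) * covDeriv τ p' q' x + conj (p x) * covDeriv τ q' g' x := by
    rw [← intervalIntegral.integral_sub i1 i2, ← intervalIntegral.integral_sub i3 i4]
    refine intervalIntegral.integral_congr fun x _ => ?_
    simp only [covDerivTwo, covDeriv, map_add, map_mul, Complex.conj_I, Complex.conj_ofReal]
    ring
  have k1 : ∀ x, conj (-(κ : ℂ) * covDerivTwo τ p q g x) * p' x
      = -(κ : ℂ) * (conj (covDerivTwo τ p q g x) * p' x) := fun x => by
    simp only [map_mul, map_neg, Complex.conj_ofReal]; ring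
  have k2 : ∀ x, conj (p x) * (-(κ : ℂ) * covDerivTwo τ p' q' g' x)
      = -(κ : ℂ) * (conj (p x) * covDerivTwo τ p' q' g' x) := fun x => by ring
  simp only [k1, k2, intervalIntegral.integral_const_mul]
  rw [← mul_sub, key]
  linear_combination (κ : ℂ) * (e3 - e4)

end edge

/-! ### Solvability on an edge -/

theorem ContinuousOn.memLp_edge {ℓ : ℝ} {p : ℝ → ℂ} (h : ContinuousOn p (Icc 0 ℓ)) :
    MemLp p 2 (volume.restrict (Ioo (0 : ℝ) ℓ)) := by
  obtain ⟨C, hC⟩ := isCompact_Icc.exists_bound_of_continuousOn h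
  refine MemLp.of_bound
    ((h.mono Ioo_subset_Icc_self).aestronglyMeasurable measurableSet_Ioo) C ?_
  filter_upwards [ae_restrict_mem measurableSet_Ioo] with x hx
  exact hC x (Ioo_subset_Icc_self hx)

/-- Variation of constants: `w(x) = e^{c₀ x} (c + ∫₀ˣ e^{-c₀ t} b(t) dt)`. -/
theorem exists_primitive_linear_eq {ℓ : ℝ} (hℓ : 0 ≤ ℓ) (c₀ c : ℂ) {b : ℝ → ℂ}
    (hb : IntervalIntegrable b volume 0 ℓ) :
    ∃ w : ℝ → ℂ, w 0 = c ∧ ContinuousOn w (Icc 0 ℓ) ∧ IsPrimitiveOn ℓ w (fun x => c₀ * w x + b x) := by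
  have hd : ∀ (d : ℂ) (x : ℝ), HasDerivAt (fun x : ℝ => Complex.exp (d * x))
      (d * Complex.exp (d * x)) x := fun d x => by
    have := ((Complex.ofRealCLM.hasDerivAt (x := x)).const_mul d).cexp
    simpa [mul_comm] using this
  have hI : IntervalIntegrable (fun t : ℝ => Complex.exp (-c₀ * t) * b t) volume 0 ℓ :=
    hb.continuousOn_mul (by fun_prop)
  have h1 : IsPrimitiveOn ℓ (fun x : ℝ => Complex.exp (c₀ * x)) _ :=
    IsPrimitiveOn.of_hasDerivAt (hd c₀) (by fun_prop)
  have h2 : IsPrimitiveOn ℓ (fun x => c + ∫ t in (0 : ℝ)..x, Complex.exp (-c₀ * t) * b t)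
      (fun t : ℝ => Complex.exp (-c₀ * t) * b t) := fun x _ => by simp
  refine ⟨_, ?_, ?_, (h1.mul hℓ h2 ((by fun_prop : Continuous _).intervalIntegrable _ _) hI).congr ?_⟩
  · simp
  · refine ContinuousOn.mul (by fun_prop) (h2.continuousOn fun x hx => hI.mono_set ?_)
    rw [uIcc_of_le hx.1, uIcc_of_le hℓ]
    exact Icc_subset_Icc_right hx.2
  · intro x _
    have : Complex.exp (c₀ * x) * Complex.exp (-c₀ * x) = 1 := by
      rw [← Complex.exp_add]; simp
    linear_combination b x * this

/-- With `μ² = -z/κ` the equation reads `(∂ - μ)(∂ + μ) u = -h/κ`, where `∂ = d/dx + iτ`. Two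
first-order linear equations are solved in turn, the first for `w = (∂ + μ) u`. -/
theorem exists_edge_solution {ℓ κ : ℝ} (hℓ : 0 ≤ ℓ) (hκ : κ ≠ 0) (τ : ℝ) (z : ℂ)
    (h : EdgeL2 ℓ) (α β : ℂ) :
    ∃ (u f : EdgeL2 ℓ) (p q : ℝ → ℂ) (g : EdgeL2 ℓ), IsW22 ℓ u p q g ∧
      IsEdgeAction ℓ κ τ p q g f ∧ f - z • u = h ∧ p 0 = α ∧ q 0 = β := by
  have hκ' : (κ : ℂ) ≠ 0 := by exact_mod_cast hκ
  obtain ⟨μ, hμ⟩ := IsAlgClosed.exists_pow_nat_eq (-(z / κ)) (n := 2) (by norm_num)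
  have hhi : IntervalIntegrable (fun x => -(1 / (κ : ℂ)) * h x) volume 0 ℓ :=
    (h.intervalIntegrable ⟨hℓ, le_rfl⟩).const_mul _
  obtain ⟨w, hw0, hwc, hw⟩ := exists_primitive_linear_eq hℓ (μ - Complex.I * τ)
    (β - (-μ - Complex.I * τ) * α) hhi
  obtain ⟨p, hp0, hpc, hp⟩ := exists_primitive_linear_eq hℓ (-μ - Complex.I * τ) α
    (hwc.mono (uIcc_of_le hℓ).subset).intervalIntegrable
  set q : ℝ → ℂ := fun x => (-μ - Complex.I * τ) * p x + w x with hq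
  have hqc : ContinuousOn q (Icc 0 ℓ) := (hpc.const_mul _).add hwc
  have hii : ∀ {f : ℝ → ℂ}, ContinuousOn f (Icc 0 ℓ) → ∀ x ∈ Icc 0 ℓ,
      IntervalIntegrable f volume 0 x := fun hf x hx => ContinuousOn.intervalIntegrable
    (hf.mono (by rw [uIcc_of_le hx.1]; exact Icc_subset_Icc_right hx.2))
  have hq' := (hp.smul (-μ - Complex.I * τ)).add hw
    (fun x hx => (hii hqc x hx).const_mul _)
    (fun x hx => ((hii hwc x hx).const_mul _).add ((h.intervalIntegrable hx).const_mul _))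
  set u := hpc.memLp_edge.toLp p
  set v := hqc.memLp_edge.toLp q
  set y := hwc.memLp_edge.toLp w
  set g : EdgeL2 ℓ := (-μ - Complex.I * τ) • v + ((μ - Complex.I * τ) • y + -(1 / (κ : ℂ)) • h)
  have hu : u =ᵐ[volume.restrict (Ioo (0 : ℝ) ℓ)] p := MemLp.coeFn_toLp _
  have hv : v =ᵐ[volume.restrict (Ioo (0 : ℝ) ℓ)] q := MemLp.coeFn_toLp _
  have hy : y =ᵐ[volume.restrict (Ioo (0 : ℝ) ℓ)] w := MemLp.coeFn_toLp _
  have hg : g =ᵐ[volume.restrict (Ioo (0 : ℝ) ℓ)] fun x => (-μ - Complex.I * τ) * q x +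
      ((μ - Complex.I * τ) * w x + -(1 / (κ : ℂ)) * h x) := by
    filter_upwards [hv, hy, Lp.coeFn_add ((-μ - Complex.I * τ) • v)
      ((μ - Complex.I * τ) • y + -(1 / (κ : ℂ)) • h),
      Lp.coeFn_add ((μ - Complex.I * τ) • y) (-(1 / (κ : ℂ)) • h),
      Lp.coeFn_smul (-μ - Complex.I * τ) v, Lp.coeFn_smul (μ - Complex.I * τ) y,
      Lp.coeFn_smul (-(1 / (κ : ℂ))) h] with x h1 h2 h3 h4 h5 h6 h7
    rw [h3, Pi.add_apply, h4, Pi.add_apply, h5, h6, h7]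
    simp only [Pi.smul_apply, smul_eq_mul, h1, h2]
  refine ⟨u, h + z • u, p, q, g, ⟨hu, hp, hq'.congr_ae hg.symm⟩, ?_, by simp, hp0, ?_⟩
  · unfold IsEdgeAction
    filter_upwards [hu, hg, Lp.coeFn_add h (z • u), Lp.coeFn_smul z u] with x h1 h2 h3 h4
    rw [h3, Pi.add_apply, h4, Pi.smul_apply, h1]
    simp only [covDerivTwo, covDeriv, h2, hq, smul_eq_mul]
    have e : z = -κ * μ ^ 2 := by rw [hμ]; field_simp
    rw [e]
    field_simp
    ring
  · simp only [hq, hp0, hw0]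
    ring

/-! ### A priori bounds on an edge -/

theorem EdgeL2.exists_norm_integral_le (ℓ : ℝ) : ∃ C : ℝ, 0 ≤ C ∧ ∀ (f : EdgeL2 ℓ),
    ∫ x in Ioo 0 ℓ, ‖f x‖ ≤ C * ‖f‖ := by
  refine ⟨((volume.restrict (Ioo (0 : ℝ) ℓ)) univ ^ (1 / (1 : ENNReal).toReal
    - 1 / (2 : ENNReal).toReal)).toReal, ENNReal.toReal_nonneg, fun f => ?_⟩
  have hf := Lp.aestronglyMeasurable f
  have h := eLpNorm_le_eLpNorm_mul_rpow_measure_univ (p := 1) (q := 2) (by norm_num) hf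
  rw [integral_norm_eq_lintegral_enorm hf, ← eLpNorm_one_eq_lintegral_enorm, Lp.norm_def,
    ← ENNReal.toReal_mul, mul_comm]
  refine ENNReal.toReal_mono (ENNReal.mul_ne_top (Lp.eLpNorm_ne_top f) ?_) h
  exact ENNReal.rpow_ne_top_of_nonneg (by norm_num) (by simp)

theorem EdgeL2.exists_norm_le_of_bound (ℓ : ℝ) : ∃ C : ℝ, 0 ≤ C ∧ ∀ (f : EdgeL2 ℓ) (M : ℝ),
    0 ≤ M → (∀ᵐ x ∂volume.restrict (Ioo (0 : ℝ) ℓ), ‖f x‖ ≤ M) → ‖f‖ ≤ C * M :=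
  ⟨_, by positivity, fun _ _ hM h => Lp.norm_le_of_ae_bound hM h⟩

/-- The solution of `(d/dx + iτ) u = 0` with value `1` at `0`. -/
noncomputable def edgePhase (τ x : ℝ) : ℂ := Complex.exp (-(Complex.I * τ * x))

theorem norm_edgePhase (τ x : ℝ) : ‖edgePhase τ x‖ = 1 := by
  rw [edgePhase, show -(Complex.I * τ * x) = ((-(τ * x) : ℝ) : ℂ) * Complex.I by push_cast; ring,
    Complex.norm_exp_ofReal_mul_I]

theorem edgePhase_zero (τ : ℝ) : edgePhase τ 0 = 1 := by simp [edgePhase]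

theorem conj_edgePhase_mul (τ x : ℝ) : conj (edgePhase τ x) * edgePhase τ x = 1 := by
  rw [← Complex.normSq_eq_conj_mul_self, Complex.normSq_eq_norm_sq, norm_edgePhase]; simp

theorem hasDerivAt_edgePhase (τ x : ℝ) :
    HasDerivAt (edgePhase τ) (-(Complex.I * τ) * edgePhase τ x) x := by
  have := ((Complex.ofRealCLM.hasDerivAt (x := x)).const_mul (Complex.I * τ)).fun_neg.cexp
  change HasDerivAt (fun y : ℝ => Complex.exp (-(Complex.I * τ * y))) _ x
  simpa [edgePhase, mul_comm, Function.comp_def] using this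

theorem continuous_edgePhase (τ : ℝ) : Continuous (edgePhase τ) := by
  unfold edgePhase; fun_prop

section bounds

variable {ℓ κ τ : ℝ} {u f : EdgeL2 ℓ} {p q : ℝ → ℂ} {g : EdgeL2 ℓ}

/-- Gauge transformation: multiplication by `e^{iτx}` turns `d/dx + iτ` into `d/dx`, without
changing absolute values. -/
theorem IsW22.gauge_isPrimitiveOn (h : IsW22 ℓ u p q g) (hℓ : 0 ≤ ℓ) :
    IsPrimitiveOn ℓ (fun x => conj (edgePhase τ x) * p x)
      (fun x => conj (edgePhase τ x) * covDeriv τ p q x) := by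
  have hc := continuous_edgePhase τ
  have h1 := IsPrimitiveOn.of_hasDerivAt (ℓ := ℓ) (hasDerivAt_edgePhase τ) (by fun_prop)
  refine (h1.conj.mul hℓ h.deriv (intervalIntegrable_conj
    ((by fun_prop : Continuous _).intervalIntegrable _ _))
    (h.intervalIntegrable_snd ⟨hℓ, le_rfl⟩)).congr fun x _ => ?_
  simp only [covDeriv, map_mul, map_neg, Complex.conj_I, Complex.conj_ofReal]
  ring

theorem IsW22.gauge_covDeriv_isPrimitiveOn (h : IsW22 ℓ u p q g) (hℓ : 0 ≤ ℓ) :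
    IsPrimitiveOn ℓ (fun x => conj (edgePhase τ x) * covDeriv τ p q x)
      (fun x => conj (edgePhase τ x) * covDerivTwo τ p q g x) := by
  have hc := continuous_edgePhase τ
  have h1 := IsPrimitiveOn.of_hasDerivAt (ℓ := ℓ) (hasDerivAt_edgePhase τ) (by fun_prop)
  refine (h1.conj.mul hℓ h.covDeriv_isPrimitiveOn (intervalIntegrable_conj
    ((by fun_prop : Continuous _).intervalIntegrable _ _))
    (h.intervalIntegrable_covDeriv_snd hℓ)).congr fun x _ => ?_
  simp only [covDerivTwo, covDeriv, map_mul, map_neg, Complex.conj_I, Complex.conj_ofReal]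
  ring

/-- The function `e^{iτx} ∂u` is a primitive of `-e^{iτx} f/κ`, and the `L¹` norm on a bounded
interval is controlled by the `L²` norm. The factor `1/κ` is kept explicit, since on the stiff edge
it supplies `ε²`. -/
theorem exists_norm_gauge_covDeriv_sub_le {ℓ : ℝ} (hℓ : 0 ≤ ℓ) : ∃ C : ℝ, 0 ≤ C ∧
    ∀ (κ τ : ℝ) (u f : EdgeL2 ℓ) (p q : ℝ → ℂ) (g : EdgeL2 ℓ), 0 < κ → IsW22 ℓ u p q g →
      IsEdgeAction ℓ κ τ p q g f → ∀ x ∈ Icc 0 ℓ,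
        ‖conj (edgePhase τ x) * covDeriv τ p q x - covDeriv τ p q 0‖ ≤ C / κ * ‖f‖ := by
  obtain ⟨C, hC, hCf⟩ := EdgeL2.exists_norm_integral_le ℓ
  refine ⟨C, hC, fun κ τ u f p q g hκ h hf x hx => ?_⟩
  have hκ' : (κ : ℂ) ≠ 0 := by exact_mod_cast hκ.ne'
  have e1 := h.gauge_covDeriv_isPrimitiveOn (τ := τ) hℓ x hx
  simp only [edgePhase_zero, map_one, one_mul] at e1
  rw [e1, add_sub_cancel_left, intervalIntegral.integral_of_le hx.1, integral_Ioc_eq_integral_Ioo]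
  have hfi : IntegrableOn (fun x => ‖f x‖) (Ioo 0 ℓ) volume :=
    ((Lp.memLp f).integrable (by norm_num)).norm
  have hsub : Ioo 0 x ⊆ Ioo 0 ℓ := Ioo_subset_Ioo_right hx.2
  calc ‖∫ t in Ioo 0 x, conj (edgePhase τ t) * covDerivTwo τ p q g t‖
      ≤ ∫ t in Ioo 0 x, ‖f t‖ / κ := by
        refine norm_integral_le_of_norm_le ((hfi.mono_set hsub).div_const κ) ?_
        filter_upwards [ae_restrict_of_ae_restrict_of_subset hsub hf] with t ht
        rw [ht]
        simp only [norm_mul, norm_neg, RCLike.norm_conj, norm_edgePhase, one_mul,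
          Complex.norm_real, Real.norm_of_nonneg hκ.le]
        rw [mul_div_cancel_left₀ _ hκ.ne']
    _ = (∫ t in Ioo 0 x, ‖f t‖) / κ := integral_div _ _
    _ ≤ (C * ‖f‖) / κ := by
        gcongr
        exact (setIntegral_mono_set hfi (by filter_upwards with t using norm_nonneg _)
          hsub.eventuallyLE).trans (hCf f)
    _ = C / κ * ‖f‖ := by ring

/-- A profile `c` multiplied by the phase `e^{-iτx}`: co-derivatives act on the profile as ordinary
derivatives, so the sizes of `u` and `f` do not depend on `τ`. -/
theorem edge_testFunction {ℓ : ℝ} (κ τ : ℝ) {c c' c'' : ℝ → ℂ}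
    (hc : ∀ x, HasDerivAt c (c' x) x) (hc' : ∀ x, HasDerivAt c' (c'' x) x)
    (hc'' : Continuous c'') : ∃ (u f : EdgeL2 ℓ) (p q : ℝ → ℂ) (g : EdgeL2 ℓ),
      IsW22 ℓ u p q g ∧ IsEdgeAction ℓ κ τ p q g f ∧ (p = fun x => edgePhase τ x * c x) ∧
      (covDeriv τ p q = fun x => edgePhase τ x * c' x) ∧
      (∀ᵐ x ∂volume.restrict (Ioo (0 : ℝ) ℓ), ‖u x‖ = ‖c x‖) ∧
      ∀ᵐ x ∂volume.restrict (Ioo (0 : ℝ) ℓ), ‖f x‖ = |κ| * ‖c'' x‖ := by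
  have hE := continuous_edgePhase τ
  have hcc : Continuous c := continuous_iff_continuousAt.2 fun x => (hc x).continuousAt
  have hcc' : Continuous c' := continuous_iff_continuousAt.2 fun x => (hc' x).continuousAt
  set p : ℝ → ℂ := fun x => edgePhase τ x * c x with hp
  set q : ℝ → ℂ := fun x => edgePhase τ x * (c' x - Complex.I * τ * c x) with hq
  set g : ℝ → ℂ := fun x => edgePhase τ x *
    (c'' x - 2 * (Complex.I * τ) * c' x + (Complex.I * τ) ^ 2 * c x) with hg
  set f : ℝ → ℂ := fun x => -(κ : ℂ) * (edgePhase τ x * c'' x) with hf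
  have hpc : Continuous p := by fun_prop
  have hqc : Continuous q := by fun_prop
  have hgc : Continuous g := by fun_prop
  have hfc : Continuous f := by fun_prop
  have hu := MemLp.coeFn_toLp (hpc.continuousOn (s := Icc 0 ℓ)).memLp_edge
  have hgl := MemLp.coeFn_toLp (hgc.continuousOn (s := Icc 0 ℓ)).memLp_edge
  have hfl := MemLp.coeFn_toLp (hfc.continuousOn (s := Icc 0 ℓ)).memLp_edge
  refine ⟨_, hfc.continuousOn.memLp_edge.toLp f, p, q, _, ⟨hu, IsPrimitiveOn.of_hasDerivAt (fun x => ?_) hqc,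
    (IsPrimitiveOn.of_hasDerivAt (fun x => ?_) hgc).congr_ae hgl.symm⟩, ?_, rfl, ?_, ?_, ?_⟩
  · exact ((hasDerivAt_edgePhase τ x).fun_mul (hc x)).congr_deriv (by simp only [hq]; ring)
  · exact ((hasDerivAt_edgePhase τ x).fun_mul
      ((hc' x).fun_sub ((hc x).const_mul (Complex.I * τ)))).congr_deriv (by simp only [hg]; ring)
  · unfold IsEdgeAction
    filter_upwards [hgl, hfl] with x h1 h2
    rw [h2]
    simp only [covDerivTwo, covDeriv, h1]
    simp only [hp, hq, hg, hf]
    ring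
  · funext x
    simp only [covDeriv, hp, hq]
    ring
  · filter_upwards [hu] with x h1
    rw [h1, norm_mul, norm_edgePhase, one_mul]
  · filter_upwards [hfl] with x h1
    rw [h1]
    simp [hf, norm_edgePhase]

/-- Green's formula against a test function whose only nonzero boundary datum is its value `1` at
`0` isolates `κ` times the conjugate of `∂u(0)`; Cauchy–Schwarz bounds the rest uniformly in `τ`. -/
theorem exists_norm_covDeriv_zero_le {ℓ κ : ℝ} (hℓ : 0 < ℓ) (hκ : 0 < κ) : ∃ C : ℝ, 0 ≤ C ∧
    ∀ (τ : ℝ) (u f : EdgeL2 ℓ) (p q : ℝ → ℂ) (g : EdgeL2 ℓ), IsW22 ℓ u p q g →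
      IsEdgeAction ℓ κ τ p q g f → ‖covDeriv τ p q 0‖ ≤ C * (‖u‖ + ‖f‖) := by
  have hℓ' : (ℓ : ℂ) ≠ 0 := by exact_mod_cast hℓ.ne'
  -- The cubic Hermite profile: `c(0) = 1` and `c(ℓ) = c'(0) = c'(ℓ) = 0`.
  set c : ℝ → ℂ := fun x => (1 - x / ℓ) ^ 2 * (1 + 2 * x / ℓ) with hc
  set c' : ℝ → ℂ := fun x => -6 * (x / ℓ) * (1 - x / ℓ) / ℓ with hc'
  set c'' : ℝ → ℂ := fun x => -6 * (1 - 2 * (x / ℓ)) / ℓ ^ 2 with hc''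
  have hd : ∀ x : ℝ, HasDerivAt (fun x : ℝ => (x : ℂ) / ℓ) (1 / ℓ) x := fun x =>
    (Complex.ofRealCLM.hasDerivAt (x := x)).div_const _
  have h1 : ∀ x, HasDerivAt c (c' x) x := fun x => by
    have := (((hd x).const_sub 1).fun_pow 2).fun_mul (((hd x).const_mul 2).const_add 1)
    simp only [← mul_div_assoc] at this
    refine this.congr_deriv ?_
    simp only [hc', Nat.add_one_sub_one, pow_one, Nat.cast_ofNat]
    field_simp
    ring
  have h2 : ∀ x, HasDerivAt c' (c'' x) x := fun x => by
    refine ((((hd x).const_mul (-6)).fun_mul ((hd x).const_sub 1)).div_const (ℓ : ℂ)).congr_deriv ?_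
    simp only [hc'']
    field_simp
    ring
  have h3 : Continuous c'' := by fun_prop
  obtain ⟨M, hM⟩ := (isCompact_Icc (a := (0 : ℝ)) (b := ℓ)).exists_bound_of_continuousOn
    (f := c) (by fun_prop)
  obtain ⟨M', hM'⟩ := (isCompact_Icc (a := (0 : ℝ)) (b := ℓ)).exists_bound_of_continuousOn
    (f := c'') (by fun_prop)
  obtain ⟨C, hC, hCb⟩ := EdgeL2.exists_norm_le_of_bound ℓ
  set N := max |M| (κ * |M'|) with hN
  have hN0 : 0 ≤ N := (abs_nonneg M).trans (le_max_left _ _)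
  refine ⟨C * N / κ, by positivity, fun τ u f p q g h hf => ?_⟩
  obtain ⟨v, F, r, s, k, hv, hF, hr, hs, hvn, hFn⟩ := edge_testFunction (ℓ := ℓ) κ τ h1 h2 h3
  have hvN : ‖v‖ ≤ C * N := by
    refine hCb v N hN0 ?_
    filter_upwards [hvn, ae_restrict_mem measurableSet_Ioo] with x hx hx'
    rw [hx]
    exact ((hM x (Ioo_subset_Icc_self hx')).trans (le_abs_self M)).trans (le_max_left _ _)
  have hFN : ‖F‖ ≤ C * N := by
    refine hCb F N hN0 ?_
    filter_upwards [hFn, ae_restrict_mem measurableSet_Ioo] with x hx hx'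
    rw [hx, abs_of_pos hκ]
    exact (mul_le_mul_of_nonneg_left ((hM' x (Ioo_subset_Icc_self hx')).trans (le_abs_self M'))
      hκ.le).trans (le_max_right _ _)
  have hG := h.green hℓ.le hf hv hF
  have e0 : r 0 = 1 := by simp [hr, hc, edgePhase_zero]
  have e1 : r ℓ = 0 := by simp [hr, hc, hℓ']
  have e2 : covDeriv τ r s 0 = 0 := by simp [hs, hc']
  have e3 : covDeriv τ r s ℓ = 0 := by simp [hs, hc', hℓ']
  rw [e0, e1, e2, e3] at hG
  simp only [mul_one, mul_zero, sub_zero, add_zero] at hG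
  have hn := congrArg norm hG
  rw [norm_mul, RCLike.norm_conj, Complex.norm_real, Real.norm_of_nonneg hκ.le] at hn
  have hb : κ * ‖covDeriv τ p q 0‖ ≤ C * N * (‖u‖ + ‖f‖) := by
    rw [← hn]
    refine (norm_sub_le _ _).trans ?_
    have b1 := (norm_inner_le_norm (𝕜 := ℂ) f v).trans
      (mul_le_mul_of_nonneg_left hvN (norm_nonneg f))
    have b2 := (norm_inner_le_norm (𝕜 := ℂ) u F).trans
      (mul_le_mul_of_nonneg_left hFN (norm_nonneg u))
    linarith
  rw [div_mul_eq_mul_div, le_div_iff₀ hκ]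
  linarith

theorem exists_norm_covDeriv_le {ℓ κ : ℝ} (hℓ : 0 < ℓ) (hκ : 0 < κ) : ∃ C : ℝ, 0 ≤ C ∧
    ∀ (τ : ℝ) (u f : EdgeL2 ℓ) (p q : ℝ → ℂ) (g : EdgeL2 ℓ), IsW22 ℓ u p q g →
      IsEdgeAction ℓ κ τ p q g f → ∀ x ∈ Icc 0 ℓ, ‖covDeriv τ p q x‖ ≤ C * (‖u‖ + ‖f‖) := by
  obtain ⟨C, hC, h0⟩ := exists_norm_covDeriv_zero_le hℓ hκ
  obtain ⟨D, hD, h1⟩ := exists_norm_gauge_covDeriv_sub_le hℓ.le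
  refine ⟨C + D / κ, by positivity, fun τ u f p q g h hf x hx => ?_⟩
  have e0 := h0 τ u f p q g h hf
  have e1 := h1 κ τ u f p q g hκ h hf x hx
  have e2 := norm_sub_norm_le (conj (edgePhase τ x) * covDeriv τ p q x) (covDeriv τ p q 0)
  rw [norm_mul, RCLike.norm_conj, norm_edgePhase, one_mul] at e2
  have : 0 ≤ D / κ * ‖u‖ := by positivity
  linarith

end bounds

/-! ### Symmetric operators and their resolvents -/

section abstract_operators

variable {H : Type*} [NormedAddCommGroup H] [InnerProductSpace ℂ H]

/-- The linear relation `g` is symmetric. -/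
def IsSymmetricGraph (g : Submodule ℂ (H × H)) : Prop :=
  ∀ x ∈ g, ∀ y ∈ g, inner ℂ x.2 y.1 = inner ℂ x.1 y.2

/-- By symmetry `⟨x.1, x.2⟩` is real, so the imaginary part of `⟨x.1, x.2 - z x.1⟩` is `-Im z
‖x.1‖²`; Cauchy–Schwarz concludes. -/
theorem IsSymmetricGraph.abs_im_mul_norm_le {g : Submodule ℂ (H × H)} (hg : IsSymmetricGraph g)
    {x : H × H} (hx : x ∈ g) (z : ℂ) : |z.im| * ‖x.1‖ ≤ ‖x.2 - z • x.1‖ := by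
  have h1 : (inner ℂ x.1 x.2).im = 0 := by
    have h := congrArg Complex.im (hg x hx x hx)
    rw [← inner_conj_symm x.2 x.1, Complex.conj_im] at h
    linarith
  have h2 : (inner ℂ x.1 (x.2 - z • x.1)).im = -(z.im * ‖x.1‖ ^ 2) := by
    rw [inner_sub_right, inner_smul_right, inner_self_eq_norm_sq_to_K, Complex.sub_im, h1]
    simp [← Complex.ofReal_pow]
  have h3 : |z.im| * ‖x.1‖ ^ 2 ≤ ‖x.1‖ * ‖x.2 - z • x.1‖ := by
    calc |z.im| * ‖x.1‖ ^ 2 = |(inner ℂ x.1 (x.2 - z • x.1)).im| := by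
          rw [h2, abs_neg, abs_mul, abs_of_nonneg (sq_nonneg ‖x.1‖)]
      _ ≤ ‖inner ℂ x.1 (x.2 - z • x.1)‖ := Complex.abs_im_le_norm _
      _ ≤ _ := norm_inner_le_norm _ _
  rcases (norm_nonneg x.1).eq_or_lt with h0 | h0
  · rw [← h0, mul_zero]; exact norm_nonneg _
  · refine le_of_mul_le_mul_left ?_ h0
    linarith

theorem IsResolventAt.mem_graph {A : H →ₗ.[ℂ] H} {z : ℂ} {R : H →L[ℂ] H}
    (hR : IsResolventAt A z R) (f : H) : (R f, f + z • R f) ∈ A.graph := by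
  obtain ⟨h, hf⟩ := hR.1 f
  refine (LinearPMap.mem_graph_iff _).2 ⟨⟨R f, h⟩, rfl, ?_⟩
  rw [← sub_eq_iff_eq_add]
  exact hf

/-- Solutions chosen pointwise depend linearly on the data because they are unique, and the a priori
estimate bounds them with constant `1/|Im z|`. -/
theorem IsSymmetricGraph.exists_isResolventAt {A : H →ₗ.[ℂ] H} (hA : IsSymmetricGraph A.graph)
    {z : ℂ} (hz : z.im ≠ 0) (hs : ∀ h : H, ∃ x ∈ A.graph, x.2 - z • x.1 = h) :
    ∃ R : H →L[ℂ] H, IsResolventAt A z R := by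
  have hz' : 0 < |z.im| := abs_pos.2 hz
  have huniq : ∀ x ∈ A.graph, x.2 - z • x.1 = 0 → x.1 = 0 := fun x hx h => by
    have := hA.abs_im_mul_norm_le hx z
    rw [h, norm_zero] at this
    exact norm_eq_zero.1 (le_antisymm (by nlinarith) (norm_nonneg _))
  choose F hF hFs using hs
  have hext : ∀ x ∈ A.graph, (F (x.2 - z • x.1)).1 = x.1 := fun x hx => by
    refine sub_eq_zero.1 (huniq _ (A.graph.sub_mem (hF (x.2 - z • x.1)) hx) ?_)
    have := hFs (x.2 - z • x.1)
    rw [Prod.snd_sub, Prod.fst_sub, smul_sub, sub_sub_sub_comm, this, sub_self]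
  let L : H →ₗ[ℂ] H :=
    { toFun := fun h => (F h).1
      map_add' := fun h k => by
        have := hext _ (A.graph.add_mem (hF h) (hF k))
        rwa [Prod.snd_add, Prod.fst_add, smul_add, add_sub_add_comm, hFs, hFs] at this
      map_smul' := fun c h => by
        have := hext _ (A.graph.smul_mem c (hF h))
        rwa [Prod.smul_snd, Prod.smul_fst, smul_comm z c, ← smul_sub, hFs] at this }
  refine ⟨L.mkContinuous (1 / |z.im|) fun h => ?_, fun f => ?_, fun u => ?_⟩
  · have := hA.abs_im_mul_norm_le (hF h) z
    rw [hFs] at this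
    rw [one_div_mul_eq_div, le_div_iff₀ hz', mul_comm]
    exact this
  · obtain ⟨y, hy1, hy2⟩ := (LinearPMap.mem_graph_iff _).1 (hF f)
    have key : ∀ w : H, w = y → ∃ h : w ∈ A.domain, A ⟨w, h⟩ - z • w = f := by
      rintro _ rfl
      refine ⟨y.2, ?_⟩
      rw [Subtype.coe_eta, hy1]
      exact (congrArg (· - z • (F f).1) hy2).trans (hFs f)
    exact key _ hy1.symm
  · exact hext _ (LinearPMap.mem_graph A u)

/-- The range criterion for self-adjointness. Density of the domain is not assumed; it follows from
surjectivity as well. -/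
theorem IsSymmetricGraph.isSelfAdjoint [CompleteSpace H] {A : H →ₗ.[ℂ] H}
    (hA : IsSymmetricGraph A.graph) (z : ℂ)
    (hs : ∀ h : H, ∃ x ∈ A.graph, x.2 - z • x.1 = h)
    (hs' : ∀ h : H, ∃ x ∈ A.graph, x.2 - conj z • x.1 = h) : IsSelfAdjoint A := by
  -- Every adjoint pair lies in the graph: if `(A - z̄) x = w - z̄ y`, then `y - x` is orthogonal to
  -- the range of `A - z`, which is everything.
  have key : ∀ y w : H, (∀ x ∈ A.graph, inner ℂ w x.1 = inner ℂ y x.2) → (y, w) ∈ A.graph := by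
    intro y w hyw
    obtain ⟨x, hx, hxe⟩ := hs' (w - conj z • y)
    have hy : y - x.1 = 0 := by
      obtain ⟨t, ht, hte⟩ := hs (y - x.1)
      rw [← inner_self_eq_zero (𝕜 := ℂ)]
      have e1 := hyw t ht
      have e2 := hA x hx t ht
      have e3 : inner ℂ (x.2 - conj z • x.1) t.1 = inner ℂ (w - conj z • y) t.1 := by rw [hxe]
      simp only [inner_sub_left, inner_smul_left, Complex.conj_conj] at e3
      nth_rewrite 2 [← hte]
      simp only [inner_sub_right, inner_sub_left, inner_smul_right]
      linear_combination -e3 - e1 + e2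
    have hy' : x.1 = y := (sub_eq_zero.1 hy).symm
    have hw : x.2 = w := by
      rw [hy'] at hxe
      exact sub_left_inj.1 hxe
    rw [← hy', ← hw]
    exact hx
  have hdense : Dense (A.domain : Set H) := by
    rw [Submodule.dense_iff_topologicalClosure_eq_top,
      Submodule.topologicalClosure_eq_top_iff, Submodule.eq_bot_iff]
    intro w hw
    -- A vector `w` orthogonal to the domain makes `(0, w)` an adjoint pair, whence `w = A 0 = 0`.
    have h0 : (0, w) ∈ A.graph := key 0 w fun x hx => by
      rw [inner_zero_left]
      exact (Submodule.mem_orthogonal' _ _).1 hw _ (LinearPMap.mem_domain_of_mem_graph hx)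
    obtain ⟨y, hy1, hy2⟩ := (LinearPMap.mem_graph_iff _).1 h0
    have : y = 0 := Subtype.ext hy1
    rw [← show A y = w from hy2, this, LinearPMap.map_zero]
  rw [LinearPMap.isSelfAdjoint_def]
  refine LinearPMap.eq_of_eq_graph ?_
  rw [LinearPMap.adjoint_graph_eq_graph_adjoint hdense]
  ext ⟨y, w⟩
  rw [Submodule.mem_adjoint_iff]
  constructor
  · intro h
    refine key y w fun x hx => ?_
    have := sub_eq_zero.1 (h x.1 x.2 hx)
    rw [← inner_conj_symm, ← inner_conj_symm y]
    exact congrArg conj this.symm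
  · intro h s t hst
    rw [sub_eq_zero]
    exact hA _ hst _ h

end abstract_operators

/-- Reduces a boundary value problem to uniqueness. Here `S` is the differential expression, `B` the
boundary conditions, and `J` produces homogeneous solutions from Cauchy data in `V`. A particular
solution is corrected by `J v`, and `B ∘ J` is bijective because it is injective between spaces of
equal finite dimension. -/
theorem exists_eq_and_eq_of_injective {V W M H : Type*} [AddCommGroup V] [Module ℂ V]
    [FiniteDimensional ℂ V] [AddCommGroup W] [Module ℂ W] [FiniteDimensional ℂ W]
    [AddCommGroup M] [Module ℂ M] [AddCommGroup H] [Module ℂ H] (S : M →ₗ[ℂ] H) (B : M →ₗ[ℂ] W)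
    (J : V →ₗ[ℂ] M) (hS : Function.Surjective S) (hSJ : ∀ v, S (J v) = 0)
    (hd : Module.finrank ℂ V = Module.finrank ℂ W) (hB : ∀ v, B (J v) = 0 → v = 0) (h : H) (w : W) :
    ∃ m, S m = h ∧ B m = w := by
  have hi : Function.Injective (B ∘ₗ J) := LinearMap.ker_eq_bot.1 (LinearMap.ker_eq_bot'.2 hB)
  obtain ⟨m, rfl⟩ := hS h
  obtain ⟨v, hv⟩ := (LinearMap.injective_iff_surjective_of_finrank_eq_finrank hd).1 hi (w - B m)
  refine ⟨m + J v, by rw [map_add, hSJ, add_zero], ?_⟩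
  rw [map_add, show B (J v) = w - B m from hv, add_sub_cancel]

/-! ### The space of edge functions -/

/-- The tuples `(u, f, p, q, g)` with `u ∈ W^{2,2}(0, ℓ)` represented by `p`, with derivatives
`q` and `g`, and `f = -κ (d/dx + iτ)² u`. -/
def edgeSpace (ℓ κ τ : ℝ) :
    Submodule ℂ (EdgeL2 ℓ × EdgeL2 ℓ × (ℝ → ℂ) × (ℝ → ℂ) × EdgeL2 ℓ) where
  carrier := {m | IsW22 ℓ m.1 m.2.2.1 m.2.2.2.1 m.2.2.2.2 ∧
    IsEdgeAction ℓ κ τ m.2.2.1 m.2.2.2.1 m.2.2.2.2 m.2.1}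
  add_mem' h h' := ⟨h.1.add h'.1, h.2.add h'.2⟩
  zero_mem' := ⟨IsW22.zero ℓ, IsEdgeAction.zero ℓ κ τ⟩
  smul_mem' c _ h := ⟨h.1.smul c, h.2.smul c⟩

namespace edgeSpace

variable {ℓ κ τ : ℝ}

/-- `f - z u` as a function of `(u, f, p, q, g)`. -/
noncomputable def shift (ℓ κ τ : ℝ) (z : ℂ) : edgeSpace ℓ κ τ →ₗ[ℂ] EdgeL2 ℓ where
  toFun m := m.1.2.1 - z • m.1.1
  map_add' m n := by
    change (m.1.2.1 + n.1.2.1) - z • (m.1.1 + n.1.1) = _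
    rw [smul_add, add_sub_add_comm]
  map_smul' c m := by
    change c • m.1.2.1 - z • (c • m.1.1) = c • _
    rw [smul_comm, smul_sub]

/-- The value of the representative at `x`. -/
def val (ℓ κ τ x : ℝ) : edgeSpace ℓ κ τ →ₗ[ℂ] ℂ where
  toFun m := m.1.2.2.1 x
  map_add' _ _ := rfl
  map_smul' _ _ := rfl

/-- The value of `(d/dx + iτ) u` at `x`. -/
noncomputable def cov (ℓ κ τ x : ℝ) : edgeSpace ℓ κ τ →ₗ[ℂ] ℂ where
  toFun m := covDeriv τ m.1.2.2.1 m.1.2.2.2.1 x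
  map_add' m n := by
    change (m.1.2.2.2.1 x + n.1.2.2.2.1 x) + Complex.I * τ * (m.1.2.2.1 x + n.1.2.2.1 x) = _
    simp only [covDeriv]
    ring
  map_smul' c m := by
    change c * m.1.2.2.2.1 x + Complex.I * τ * (c * m.1.2.2.1 x) = c * _
    simp only [covDeriv]
    ring

theorem shift_surjective (hℓ : 0 ≤ ℓ) (hκ : κ ≠ 0) (z : ℂ) :
    Function.Surjective (shift ℓ κ τ z) := fun h => by
  obtain ⟨u, f, p, q, g, hW, hA, he, -, -⟩ := exists_edge_solution hℓ hκ τ z h 0 0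
  exact ⟨⟨(u, f, p, q, g), hW, hA⟩, he⟩

theorem exists_cauchyMap (hℓ : 0 ≤ ℓ) (hκ : κ ≠ 0) (τ : ℝ) (z : ℂ) :
    ∃ J : ℂ × ℂ →ₗ[ℂ] edgeSpace ℓ κ τ, ∀ v, shift ℓ κ τ z (J v) = 0 ∧
      (J v).1.2.2.1 0 = v.1 ∧ (J v).1.2.2.2.1 0 = v.2 := by
  obtain ⟨u, f, p, q, g, hW, hA, he, hp, hq⟩ := exists_edge_solution hℓ hκ τ z 0 1 0
  obtain ⟨u', f', p', q', g', hW', hA', he', hp', hq'⟩ := exists_edge_solution hℓ hκ τ z 0 0 1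
  let m : edgeSpace ℓ κ τ := ⟨(u, f, p, q, g), hW, hA⟩
  let m' : edgeSpace ℓ κ τ := ⟨(u', f', p', q', g'), hW', hA'⟩
  refine ⟨((LinearMap.toSpanSingleton ℂ _ m).coprod (LinearMap.toSpanSingleton ℂ _ m')),
    fun v => ⟨?_, ?_, ?_⟩⟩
  · have e1 : shift ℓ κ τ z m = 0 := he
    have e2 : shift ℓ κ τ z m' = 0 := he'
    simp [LinearMap.coprod_apply, e1, e2]
  · change v.1 * p 0 + v.2 * p' 0 = v.1
    rw [hp, hp']; ring
  · change v.1 * q 0 + v.2 * q' 0 = v.2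
    rw [hq, hq']; ring

theorem eq_zero_of_fst_eq_zero (hℓ : 0 < ℓ) {m : edgeSpace ℓ κ τ} (h : m.1.1 = 0) :
    m.1.2.2.1 0 = 0 ∧ m.1.2.2.2.1 0 = 0 := by
  have hW := m.2.1
  rw [h] at hW
  exact ⟨hW.eq_zero hℓ |>.1 0 ⟨le_rfl, hℓ.le⟩, hW.eq_zero hℓ |>.2.1 0 ⟨le_rfl, hℓ.le⟩⟩

end edgeSpace

/-! ### Green's formula on a graph -/

namespace HighContrastGraph

variable {V E : Type} [Fintype E] [DecidableEq V] [DecidableEq E]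

/-- The function `u` is edgewise in `W^{2,2}`, satisfies the weighted continuity condition with
vertex values `c`, and `f` is the result of the edgewise action of the fibre operator. -/
structure IsContinuousSol (G : HighContrastGraph V E) (ε τ : ℝ) (u f : G.L2) (p q : E → ℝ → ℂ)
    (g : G.L2) (c : V → ℂ) : Prop where
  w22 : ∀ e, IsW22 (G.len e) (u e) (p e) (q e) (g e)
  action : ∀ e, IsEdgeAction (G.len e) (G.kappa ε e) τ (p e) (q e) (g e) (f e)
  left : ∀ e, G.wLeft τ e * p e 0 = c (G.left e)
  right : ∀ e, G.wRight τ e * p e (G.len e) = c (G.right e)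

/-- Regroups a sum over vertices by edges, each edge contributing once at either end. -/
theorem sum_conj_normalSum_mul [Fintype V] (G : HighContrastGraph V E) (ε τ : ℝ)
    (p q : E → ℝ → ℂ) (c : V → ℂ) : ∑ v, conj (G.normalSum ε τ p q v) * c v =
      ∑ e, G.kappa ε e * (conj (covDeriv τ (p e) (q e) 0) * (conj (G.wLeft τ e) * c (G.left e))
        - conj (covDeriv τ (p e) (q e) (G.len e)) * (conj (G.wRight τ e) * c (G.right e))) := by
  simp only [normalSum, map_sum, Finset.sum_mul]
  rw [Finset.sum_comm]
  refine Finset.sum_congr rfl fun e _ => ?_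
  simp only [map_add, add_mul, Finset.sum_add_distrib, apply_ite conj, ite_mul, map_zero, zero_mul,
    Finset.sum_ite_eq, Finset.mem_univ, if_true, map_neg, map_mul, Complex.conj_ofReal]
  ring

/-- Weighted continuity with weights of modulus one writes an endpoint value as the conjugate weight
times the vertex value, so the boundary terms of the edges collect into normal sums. No Kirchhoff
condition is imposed, because the comparison function built from the homogenised operator need not
satisfy one. -/
theorem IsContinuousSol.green [Fintype V] {G : HighContrastGraph V E} {ε τ : ℝ}
    (hlen : ∀ e, 0 ≤ G.len e) (hwL : ∀ e, conj (G.wLeft τ e) * G.wLeft τ e = 1)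
    (hwR : ∀ e, conj (G.wRight τ e) * G.wRight τ e = 1)
    {u f : G.L2} {p q : E → ℝ → ℂ} {g : G.L2} {c : V → ℂ} (h : G.IsContinuousSol ε τ u f p q g c)
    {u' f' : G.L2} {p' q' : E → ℝ → ℂ} {g' : G.L2} {c' : V → ℂ}
    (h' : G.IsContinuousSol ε τ u' f' p' q' g' c') :
    inner ℂ f u' - inner ℂ u f' = ∑ v, conj (G.normalSum ε τ p q v) * c' v
      - ∑ v, conj (c v) * G.normalSum ε τ p' q' v := by
  have hc : ∑ v, conj (c v) * G.normalSum ε τ p' q' v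
      = conj (∑ v, conj (G.normalSum ε τ p' q' v) * c v) := by
    simp only [map_sum, map_mul, Complex.conj_conj]
    exact Finset.sum_congr rfl fun v _ => mul_comm _ _
  rw [hc, sum_conj_normalSum_mul, sum_conj_normalSum_mul, map_sum, PiLp.inner_apply,
    PiLp.inner_apply, ← Finset.sum_sub_distrib, ← Finset.sum_sub_distrib]
  refine Finset.sum_congr rfl fun e _ => ?_
  rw [(h.w22 e).green (hlen e) (h.action e) (h'.w22 e) (h'.action e)]
  have a1 := h.left e
  have a2 := h.right e
  have b1 := h'.left e
  have b2 := h'.right e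
  rw [← a1, ← a2, ← b1, ← b2]
  have wL := hwL e
  have wR := hwR e
  simp only [map_mul, map_sub, Complex.conj_conj, Complex.conj_ofReal]
  linear_combination (-(G.kappa ε e : ℂ) * (conj (covDeriv τ (p e) (q e) 0) * p' e 0
    - conj (p e 0) * covDeriv τ (p' e) (q' e) 0)) * wL
    - (-(G.kappa ε e : ℂ) * (conj (covDeriv τ (p e) (q e) (G.len e)) * p' e (G.len e)
    - conj (p e (G.len e)) * covDeriv τ (p' e) (q' e) (G.len e))) * wR

theorem mem_fibreGraph_iff (G : HighContrastGraph V E) (ε τ : ℝ) (x : G.L2 × G.L2) :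
    x ∈ G.fibreGraph ε τ ↔ ∃ p q g c, G.IsContinuousSol ε τ x.1 x.2 p q g c ∧
      ∀ v, G.normalSum ε τ p q v = 0 := by
  constructor
  · rintro ⟨p, q, g, hW, ⟨c, hc⟩, hK, hA⟩
    exact ⟨p, q, g, c, ⟨hW, hA, fun e => (hc e).1, fun e => (hc e).2⟩, hK⟩
  · rintro ⟨p, q, g, c, h, hK⟩
    exact ⟨p, q, g, h.w22, ⟨c, fun e => ⟨h.left e, h.right e⟩⟩, hK, h.action⟩

theorem isSymmetricGraph_fibreGraph [Fintype V] (G : HighContrastGraph V E) {ε τ : ℝ}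
    (hlen : ∀ e, 0 ≤ G.len e) (hwL : ∀ e, conj (G.wLeft τ e) * G.wLeft τ e = 1)
    (hwR : ∀ e, conj (G.wRight τ e) * G.wRight τ e = 1) :
    IsSymmetricGraph (G.fibreGraph ε τ) := by
  intro x hx y hy
  obtain ⟨p, q, g, c, h, hK⟩ := (G.mem_fibreGraph_iff ε τ x).1 hx
  obtain ⟨p', q', g', c', h', hK'⟩ := (G.mem_fibreGraph_iff ε τ y).1 hy
  rw [← sub_eq_zero, h.green hlen hwL hwR h']
  simp [hK, hK']

end HighContrastGraph

/-! ### The graph with one stiff edge -/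

theorem Complex.conj_exp_I_mul_mul_exp (t : ℝ) :
    conj (Complex.exp (Complex.I * t)) * Complex.exp (Complex.I * t) = 1 := by
  rw [← Complex.exp_conj, ← Complex.exp_add]
  simp

section softConnectedGraph

variable (l a : Fin 3 → ℝ)

theorem softConnectedGraph_conj_wLeft_mul (τ : ℝ) (e : Fin 3) :
    conj ((softConnectedGraph l a).wLeft τ e) * (softConnectedGraph l a).wLeft τ e = 1 := by
  have := Complex.conj_exp_I_mul_mul_exp (τ * l 2)
  push_cast at this
  fin_cases e <;> simp [softConnectedGraph]
  rwa [← mul_assoc] at this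

theorem softConnectedGraph_conj_wRight_mul (τ : ℝ) (e : Fin 3) :
    conj ((softConnectedGraph l a).wRight τ e) * (softConnectedGraph l a).wRight τ e = 1 := by
  have := Complex.conj_exp_I_mul_mul_exp (τ * (l 1 + l 2))
  push_cast at this
  fin_cases e <;> simp [softConnectedGraph]
  rwa [← mul_assoc] at this

theorem softConnectedGraph_kappa_zero {ε : ℝ} (hε : ε ≠ 0) :
    (softConnectedGraph l a).kappa ε 0 = a 0 ^ 2 := by
  simp [HighContrastGraph.kappa, softConnectedGraph]
  field_simp

theorem softConnectedGraph_kappa_one {ε : ℝ} (hε : ε ≠ 0) :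
    (softConnectedGraph l a).kappa ε 1 = a 1 ^ 2 := by
  simp [HighContrastGraph.kappa, softConnectedGraph]
  field_simp

theorem softConnectedGraph_kappa_two (ε : ℝ) :
    (softConnectedGraph l a).kappa ε 2 = a 2 ^ 2 / ε ^ 2 := by
  simp [HighContrastGraph.kappa, softConnectedGraph]

theorem softConnectedGraph_kappa_pos (ha : ∀ j, 0 < a j) {ε : ℝ} (hε : 0 < ε) (e : Fin 3) :
    0 < (softConnectedGraph l a).kappa ε e := by
  have h0 := ha 0
  have h1 := ha 1
  have h2 := ha 2
  fin_cases e
  · change 0 < (softConnectedGraph l a).kappa ε 0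
    rw [softConnectedGraph_kappa_zero l a hε.ne']; positivity
  · change 0 < (softConnectedGraph l a).kappa ε 1
    rw [softConnectedGraph_kappa_one l a hε.ne']; positivity
  · change 0 < (softConnectedGraph l a).kappa ε 2
    rw [softConnectedGraph_kappa_two l a]; positivity

theorem softConnectedGraph_normalSum_zero {ε : ℝ} (hε : ε ≠ 0) (τ : ℝ) (p q : Fin 3 → ℝ → ℂ) :
    (softConnectedGraph l a).normalSum ε τ p q 0 =
      (a 1 : ℂ) ^ 2 * covDeriv τ (p 1) (q 1) 0 - (a 0 : ℂ) ^ 2 * covDeriv τ (p 0) (q 0) (l 0)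
      - Complex.exp (Complex.I * τ * (l 1 + l 2)) * (a 2 ^ 2 / ε ^ 2 : ℝ)
        * covDeriv τ (p 2) (q 2) (l 2) := by
  simp only [HighContrastGraph.normalSum, Fin.sum_univ_three, softConnectedGraph_kappa_zero l a hε,
    softConnectedGraph_kappa_one l a hε, softConnectedGraph_kappa_two]
  simp [softConnectedGraph]
  ring

theorem softConnectedGraph_normalSum_one {ε : ℝ} (hε : ε ≠ 0) (τ : ℝ) (p q : Fin 3 → ℝ → ℂ) :
    (softConnectedGraph l a).normalSum ε τ p q 1 =
      Complex.exp (Complex.I * τ * l 2) * (a 0 : ℂ) ^ 2 * covDeriv τ (p 0) (q 0) 0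
      - (a 1 : ℂ) ^ 2 * covDeriv τ (p 1) (q 1) (l 1)
      + (a 2 ^ 2 / ε ^ 2 : ℝ) * covDeriv τ (p 2) (q 2) 0 := by
  simp only [HighContrastGraph.normalSum, Fin.sum_univ_three, softConnectedGraph_kappa_zero l a hε,
    softConnectedGraph_kappa_one l a hε, softConnectedGraph_kappa_two]
  simp [softConnectedGraph]
  ring

variable {l a}

theorem isSymmetricGraph_fibreOp (hl : ∀ j, 0 < l j) (ε τ : ℝ) :
    IsSymmetricGraph ((softConnectedGraph l a).fibreOp ε τ).graph := by
  rw [HighContrastGraph.fibreOp_graph _ hl]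
  exact HighContrastGraph.isSymmetricGraph_fibreGraph _ (fun e => (hl e).le)
    (softConnectedGraph_conj_wLeft_mul l a τ) (softConnectedGraph_conj_wRight_mul l a τ)

/-- Three edges carry six Cauchy data, matched by four continuity and two Kirchhoff conditions. -/
theorem exists_mem_fibreOp_graph (hl : ∀ j, 0 < l j) (ha : ∀ j, 0 < a j) {ε : ℝ} (hε : 0 < ε)
    (τ : ℝ) {z : ℂ} (hz : z.im ≠ 0) : ∀ h : (softConnectedGraph l a).L2,
    ∃ x ∈ ((softConnectedGraph l a).fibreOp ε τ).graph, x.2 - z • x.1 = h := by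
  have hsym := isSymmetricGraph_fibreOp (a := a) hl ε τ
  rw [HighContrastGraph.fibreOp_graph _ hl] at hsym ⊢
  set G := softConnectedGraph l a with hG
  intro h
  have hlen : ∀ e, 0 < G.len e := hl
  have hκ := softConnectedGraph_kappa_pos l a ha hε
  let M := ∀ e : Fin 3, edgeSpace (G.len e) (G.kappa ε e) τ
  let ev : ∀ e : Fin 3, M →ₗ[ℂ] edgeSpace (G.len e) (G.kappa ε e) τ := fun e => LinearMap.proj e
  let L : Fin 3 → M →ₗ[ℂ] ℂ := fun e => G.wLeft τ e • (edgeSpace.val _ _ _ 0 ∘ₗ ev e)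
  let R : Fin 3 → M →ₗ[ℂ] ℂ := fun e => G.wRight τ e • (edgeSpace.val _ _ _ (G.len e) ∘ₗ ev e)
  let N : Fin 2 → M →ₗ[ℂ] ℂ := fun v => ∑ e,
    ((if G.left e = v then (G.wLeft τ e * G.kappa ε e) • (edgeSpace.cov _ _ _ 0 ∘ₗ ev e) else 0) +
    (if G.right e = v then
      -((G.wRight τ e * G.kappa ε e) • (edgeSpace.cov _ _ _ (G.len e) ∘ₗ ev e)) else 0))
  have hN : ∀ v (m : M), N v m = G.normalSum ε τ (fun e => (m e).1.2.2.1)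
      (fun e => (m e).1.2.2.2.1) v := fun v m => by
    simp only [N, HighContrastGraph.normalSum, LinearMap.sum_apply, LinearMap.add_apply]
    refine Finset.sum_congr rfl fun e _ => ?_
    congr 1 <;> split_ifs <;> rfl
  -- The common vertex values are eliminated: the two ends of `e^{(2)}` serve as reference at `V₁`
  -- and `V₂`.
  let B : M →ₗ[ℂ] (Fin 6 → ℂ) := LinearMap.pi
    ![R 0 - L 1, R 2 - L 1, L 0 - R 1, L 2 - R 1, N 0, N 1]
  let S : M →ₗ[ℂ] (∀ e : Fin 3, EdgeL2 (G.len e)) :=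
    LinearMap.pi fun e => edgeSpace.shift _ _ _ z ∘ₗ ev e
  have hmem : ∀ m : M, B m = 0 → ((WithLp.toLp 2 fun e => (m e).1.1 : G.L2),
      (WithLp.toLp 2 fun e => (m e).1.2.1 : G.L2)) ∈ G.fibreGraph ε τ := by
    intro m hm
    have b0 : R 0 m - L 1 m = 0 := congrFun hm 0
    have b1 : R 2 m - L 1 m = 0 := congrFun hm 1
    have b2 : L 0 m - R 1 m = 0 := congrFun hm 2
    have b3 : L 2 m - R 1 m = 0 := congrFun hm 3
    have b4 : N 0 m = 0 := congrFun hm 4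
    have b5 : N 1 m = 0 := congrFun hm 5
    refine (G.mem_fibreGraph_iff ε τ _).2 ⟨fun e => (m e).1.2.2.1, fun e => (m e).1.2.2.2.1,
      WithLp.toLp 2 fun e => (m e).1.2.2.2.2, ![L 1 m, R 1 m],
      ⟨fun e => (m e).2.1, fun e => (m e).2.2, fun e => ?_, fun e => ?_⟩, fun v => ?_⟩
    · fin_cases e
      · exact sub_eq_zero.1 b2
      · rfl
      · exact sub_eq_zero.1 b3
    · fin_cases e
      · exact sub_eq_zero.1 b0
      · rfl
      · exact sub_eq_zero.1 b1
    · rw [← hN]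
      fin_cases v
      · exact b4
      · exact b5
  choose J hJ using fun e => edgeSpace.exists_cauchyMap (hlen e).le (hκ e).ne' τ z
  let JJ : (Fin 3 → ℂ × ℂ) →ₗ[ℂ] M := LinearMap.pi fun e => J e ∘ₗ LinearMap.proj e
  obtain ⟨m, hm1, hm2⟩ := exists_eq_and_eq_of_injective S B JJ
    (fun k => by
      choose m hm using fun e => edgeSpace.shift_surjective (τ := τ) (hlen e).le (hκ e).ne' z (k e)
      exact ⟨m, funext hm⟩)
    (fun v => funext fun e => (hJ e (v e)).1)
    (by simp [Module.finrank_pi_fintype])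
    -- A homogeneous solution meeting all conditions lies in the symmetric graph with `x.2 - z x.1 =
    -- 0`, so it vanishes, and with it its Cauchy data.
    (fun v hv => by
      have h1 := hmem _ hv
      have h2 := hsym.abs_im_mul_norm_le h1 z
      have h3 : (WithLp.toLp 2 fun e => (JJ v e).1.2.1 : G.L2)
          - z • (WithLp.toLp 2 fun e => (JJ v e).1.1 : G.L2) = 0 := by
        ext1 e
        exact (hJ e (v e)).1
      rw [h3, norm_zero] at h2
      have h4 : (WithLp.toLp 2 fun e => (JJ v e).1.1 : G.L2) = 0 := norm_eq_zero.1
        (le_antisymm (by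
          have := abs_pos.2 hz
          by_contra! hc
          exact absurd h2 (not_le.2 (mul_pos this hc))) (norm_nonneg _))
      funext e
      have h5 : (J e (v e)).1.1 = 0 := congrArg (fun w : G.L2 => w e) h4
      have h6 := edgeSpace.eq_zero_of_fst_eq_zero (hlen e) h5
      rw [(hJ e (v e)).2.1, (hJ e (v e)).2.2] at h6
      exact Prod.ext h6.1 h6.2) (fun e => h e) 0
  refine ⟨_, hmem m hm2, ?_⟩
  ext1 e
  exact congrFun hm1 e

end softConnectedGraph

/-! ### The homogenised operator -/

section homogenised

variable {l a : Fin 3 → ℝ}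

theorem norm_xiTwo (l : Fin 3 → ℝ) (τ : ℝ) : ‖xiTwo l τ‖ = 1 := norm_edgePhase τ (l 1)

theorem conj_xiTwo_mul (l : Fin 3 → ℝ) (τ : ℝ) : conj (xiTwo l τ) * xiTwo l τ = 1 :=
  conj_edgePhase_mul τ (l 1)

theorem conj_xiOne (l : Fin 3 → ℝ) (τ : ℝ) :
    conj (xiOne l τ) = conj (xiTwo l τ) * Complex.exp (Complex.I * τ * l 2) := by
  rw [xiOne, xiTwo, ← Complex.exp_conj, ← Complex.exp_conj, ← Complex.exp_add]
  congr 1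
  simp
  ring

theorem exp_eq_conj_xiTwo_mul (l : Fin 3 → ℝ) (τ : ℝ) :
    Complex.exp (Complex.I * τ * (l 1 + l 2)) = conj (xiTwo l τ) * conj (edgePhase τ (l 2)) := by
  rw [edgePhase, xiTwo, ← Complex.exp_conj, ← Complex.exp_conj, ← Complex.exp_add]
  congr 1
  simp
  ring

theorem stiffMode_eq (l : Fin 3 → ℝ) (τ x : ℝ) :
    stiffMode l τ x = edgePhase τ x * (xiTwo l τ / (√(l 2) : ℝ)) := by
  rw [stiffMode, edgePhase, xiTwo, ← mul_div_assoc, ← Complex.exp_add]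
  congr 2
  ring

/-- The stiff mode as an element of `L²(0, l₃)`. -/
noncomputable def stiffModeL2 (l : Fin 3 → ℝ) (τ : ℝ) : EdgeL2 (l 2) := (memLp_stiffMode l τ).toLp (stiffMode l τ)

theorem norm_stiffModeL2 (hl : 0 < l 2) (τ : ℝ) : ‖stiffModeL2 l τ‖ = 1 := by
  have h : stiffModeL2 l τ =ᵐ[volume.restrict (Ioo (0 : ℝ) (l 2))] stiffMode l τ :=
    MemLp.coeFn_toLp (memLp_stiffMode l τ)
  have h1 : inner ℂ (stiffModeL2 l τ) (stiffModeL2 l τ) = 1 := by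
    rw [EdgeL2.inner_eq_intervalIntegral hl.le h h]
    have : ∀ x, conj (stiffMode l τ x) * stiffMode l τ x = ((1 / l 2 : ℝ) : ℂ) := fun x => by
      rw [stiffMode_eq]
      have e1 := conj_edgePhase_mul τ x
      have e2 := conj_xiTwo_mul l τ
      have e3 : ((√(l 2) : ℝ) : ℂ) * (√(l 2) : ℝ) = (l 2 : ℂ) := by
        exact_mod_cast Real.mul_self_sqrt hl.le
      simp only [map_mul, map_div₀, Complex.conj_ofReal]
      calc _ = (conj (edgePhase τ x) * edgePhase τ x) * (conj (xiTwo l τ) * xiTwo l τ)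
          / (((√(l 2) : ℝ) : ℂ) * (√(l 2) : ℝ)) := by ring
        _ = _ := by rw [e1, e2, e3]; push_cast; ring
    simp only [this, intervalIntegral.integral_const, sub_zero]
    simp [hl.ne']
  have h2 : ‖stiffModeL2 l τ‖ ^ 2 = 1 := by rw [← inner_self_eq_norm_sq (𝕜 := ℂ), h1]; simp
  nlinarith [norm_nonneg (stiffModeL2 l τ)]

/-- A function on the graph, given by its restrictions to the three edges. -/
noncomputable def graphTriple (l a : Fin 3 → ℝ) (u₀ : EdgeL2 (l 0)) (u₁ : EdgeL2 (l 1)) (u₂ : EdgeL2 (l 2)) :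
    (softConnectedGraph l a).L2 :=
  WithLp.toLp 2 fun e : Fin 3 => match e with
    | 0 => u₀
    | 1 => u₁
    | 2 => u₂

theorem graphTriple_inner (u₀ v₀ : EdgeL2 (l 0)) (u₁ v₁ : EdgeL2 (l 1)) (u₂ v₂ : EdgeL2 (l 2)) :
    inner ℂ (graphTriple l a u₀ u₁ u₂) (graphTriple l a v₀ v₁ v₂)
      = inner ℂ u₀ v₀ + inner ℂ u₁ v₁ + inner ℂ u₂ v₂ := by
  rw [PiLp.inner_apply, Fin.sum_univ_three]
  rfl

/-- The stiff mode is the phase times a constant profile. It carries no flux and is annihilated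
whatever `κ` is, so `ε` does not enter. -/
theorem exists_stiffMode_w22 (l : Fin 3 → ℝ) (κ τ : ℝ) (β : ℂ) :
    ∃ (p q : ℝ → ℂ) (g : EdgeL2 (l 2)), IsW22 (l 2) (β • stiffModeL2 l τ) p q g ∧
      IsEdgeAction (l 2) κ τ p q g 0 ∧ (∀ x, p x = edgePhase τ x * (xiTwo l τ *
        (β / (√(l 2) : ℝ)))) ∧ ∀ x, covDeriv τ p q x = 0 := by
  obtain ⟨u, f, p, q, g, hW, hA, hp, hq, -, hf⟩ := edge_testFunction (ℓ := l 2) κ τ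
    (c := fun _ => xiTwo l τ * (β / (√(l 2) : ℝ))) (c' := fun _ => 0) (c'' := fun _ => 0)
    (fun x => hasDerivAt_const x _) (fun x => hasDerivAt_const x _) continuous_const
  have hf0 : f = 0 := by
    refine Lp.ext ?_
    filter_upwards [hf, Lp.coeFn_zero ℂ 2 (volume.restrict (Ioo (0 : ℝ) (l 2)))] with x h1 h2
    rw [h2]
    simpa using h1
  have hu : u = β • stiffModeL2 l τ := by
    refine Lp.ext ?_
    filter_upwards [hW.repr, Lp.coeFn_smul β (stiffModeL2 l τ),
      MemLp.coeFn_toLp (memLp_stiffMode l τ)] with x h1 h2 h3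
    rw [h1, h2, Pi.smul_apply, hp, stiffModeL2, h3, stiffMode_eq, smul_eq_mul]
    ring
  subst hf0 hu
  exact ⟨p, q, g, hW, hA, fun x => congrFun hp x, fun x => by rw [hq]; simp⟩

/-- Elements of the graph of the homogenised operator extend by a multiple of the stiff mode to
functions on the graph that satisfy the weighted continuity conditions. -/
theorem exists_isContinuousSol_of_mem_homGraph (hl : ∀ j, 0 < l j) {ε : ℝ} (hε : ε ≠ 0) {τ : ℝ}
    {x : HomSpace l × HomSpace l} (hx : x ∈ homGraph l a τ) :
    ∃ p q g, (softConnectedGraph l a).IsContinuousSol ε τ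
      (graphTriple l a x.1.fst x.1.snd.fst (x.1.snd.snd • stiffModeL2 l τ))
      (graphTriple l a x.2.fst x.2.snd.fst 0) p q g
      ![x.1.snd.snd / (√(l 2) : ℝ), xiTwo l τ * (x.1.snd.snd / (√(l 2) : ℝ))] ∧
      (∀ t, covDeriv τ (p 2) (q 2) t = 0) ∧
      (softConnectedGraph l a).normalSum ε τ p q 0
        + conj (xiTwo l τ) * (softConnectedGraph l a).normalSum ε τ p q 1
        = -((√(l 2) : ℝ) * x.2.snd.snd) := by
  obtain ⟨p₁, q₁, p₂, q₂, g₁, g₂, hW₁, hW₂, ⟨h1, h2, h3, h4⟩, hA₁, hA₂, hF⟩ := hx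
  obtain ⟨p₃, q₃, g₃, hW₃, hA₃, hp₃, hq₃⟩ := exists_stiffMode_w22 l
    ((softConnectedGraph l a).kappa ε 2) τ x.1.snd.snd
  have hs : ((√(l 2) : ℝ) : ℂ) ≠ 0 := by
    exact_mod_cast (Real.sqrt_pos.2 (hl 2)).ne'
  have hξ := conj_xiTwo_mul l τ
  refine ⟨![p₁, p₂, p₃], ![q₁, q₂, q₃], graphTriple l a g₁ g₂ g₃,
    ⟨fun e => ?_, fun e => ?_, fun e => ?_, fun e => ?_⟩, fun t => hq₃ t, ?_⟩
  · fin_cases e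
    exacts [hW₁, hW₂, hW₃]
  · fin_cases e
    · change IsEdgeAction (l 0) ((softConnectedGraph l a).kappa ε 0) τ p₁ q₁ g₁ x.2.fst
      rw [softConnectedGraph_kappa_zero l a hε]
      exact hA₁
    · change IsEdgeAction (l 1) ((softConnectedGraph l a).kappa ε 1) τ p₂ q₂ g₂ x.2.snd.fst
      rw [softConnectedGraph_kappa_one l a hε]
      exact hA₂
    · exact hA₃
  · fin_cases e
    · change Complex.exp (Complex.I * τ * l 2) * p₁ 0 = xiTwo l τ * (x.1.snd.snd / (√(l 2) : ℝ))
      rw [← h3, conj_xiOne]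
      linear_combination (-Complex.exp (Complex.I * τ * l 2) * p₁ 0) * hξ
    · change 1 * p₂ 0 = x.1.snd.snd / (√(l 2) : ℝ)
      rw [one_mul, h1]
    · change 1 * p₃ 0 = xiTwo l τ * (x.1.snd.snd / (√(l 2) : ℝ))
      rw [one_mul, hp₃, edgePhase_zero, one_mul]
  · fin_cases e
    · change 1 * p₁ (l 0) = x.1.snd.snd / (√(l 2) : ℝ)
      rw [one_mul, h4]
    · change 1 * p₂ (l 1) = xiTwo l τ * (x.1.snd.snd / (√(l 2) : ℝ))
      rw [← h2]
      linear_combination (-p₂ (l 1)) * hξ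
    · change Complex.exp (Complex.I * τ * (l 1 + l 2)) * p₃ (l 2) = x.1.snd.snd / (√(l 2) : ℝ)
      have hE := conj_edgePhase_mul τ (l 2)
      rw [exp_eq_conj_xiTwo_mul, hp₃]
      linear_combination (x.1.snd.snd / (√(l 2) : ℝ)) * (hE + (conj (edgePhase τ (l 2)) *
        edgePhase τ (l 2)) * (hξ))
  -- The homogenised flux is the Kirchhoff sum at `V₁` plus `ξ̄₂` times that at `V₂`, the stiff
  -- terms being zero. The two sums need not vanish separately.
  · rw [softConnectedGraph_normalSum_zero l a hε, softConnectedGraph_normalSum_one l a hε, hF,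
      homFlux, conj_xiOne]
    have e3 : ∀ t, covDeriv τ (![p₁, p₂, p₃] 2) (![q₁, q₂, q₃] 2) t = 0 := hq₃
    rw [e3, e3]
    change (a 1 : ℂ) ^ 2 * covDeriv τ p₂ q₂ 0 - (a 0 : ℂ) ^ 2 * covDeriv τ p₁ q₁ (l 0) - _ * 0
      + conj (xiTwo l τ) * (Complex.exp (Complex.I * τ * l 2) * (a 0 : ℂ) ^ 2 * covDeriv τ p₁ q₁ 0
      - (a 1 : ℂ) ^ 2 * covDeriv τ p₂ q₂ (l 1) + _ * 0) = _
    field_simp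
    ring

theorem homSpace_inner (u v : HomSpace l) : inner ℂ u v = inner ℂ u.fst v.fst
    + (inner ℂ u.snd.fst v.snd.fst + inner ℂ u.snd.snd v.snd.snd) := rfl

/-- Green's formula is applied to the extensions by the stiff mode, with the arbitrary choice `ε =
1`. Their vertex values have the form `(b, ξ₂ b)`, so the vertex terms involve only the controlled
combination of normal sums, which reproduces the scalar part of the inner product. -/
theorem isSymmetricGraph_homOp (hl : ∀ j, 0 < l j) (τ : ℝ) :
    IsSymmetricGraph (homOp l a τ).graph := by
  rw [homOp_graph l a hl]
  intro x hx y hy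
  obtain ⟨p, q, g, h, -, hN⟩ := exists_isContinuousSol_of_mem_homGraph hl one_ne_zero hx
  obtain ⟨p', q', g', h', -, hN'⟩ := exists_isContinuousSol_of_mem_homGraph hl one_ne_zero hy
  have hs : ((√(l 2) : ℝ) : ℂ) ≠ 0 := by
    exact_mod_cast (Real.sqrt_pos.2 (hl 2)).ne'
  have hG := h.green (fun e => (hl e).le) (softConnectedGraph_conj_wLeft_mul l a τ)
    (softConnectedGraph_conj_wRight_mul l a τ) h'
  rw [graphTriple_inner, graphTriple_inner, inner_zero_left, inner_zero_right,
    Fin.sum_univ_two, Fin.sum_univ_two] at hG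
  simp only [Matrix.cons_val_zero, Matrix.cons_val_one, map_mul, map_div₀,
    Complex.conj_ofReal] at hG
  have hN1 := congrArg conj hN
  simp only [map_add, map_mul, map_neg, Complex.conj_conj, Complex.conj_ofReal] at hN1
  rw [homSpace_inner, homSpace_inner, RCLike.inner_apply, RCLike.inner_apply]
  have k1 : y.1.snd.snd * conj x.2.snd.snd = -(conj ((softConnectedGraph l a).normalSum 1 τ p q 0)
      + xiTwo l τ * conj ((softConnectedGraph l a).normalSum 1 τ p q 1))
      * (y.1.snd.snd / (√(l 2) : ℝ)) := by
    rw [hN1]; field_simp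
  have k2 : y.2.snd.snd * conj x.1.snd.snd = -((softConnectedGraph l a).normalSum 1 τ p' q' 0
      + conj (xiTwo l τ) * (softConnectedGraph l a).normalSum 1 τ p' q' 1)
      * (conj x.1.snd.snd / (√(l 2) : ℝ)) := by
    rw [hN']; field_simp
  rw [k1, k2]
  linear_combination hG

/-- The same reduction with five unknowns, namely four Cauchy data and `β`, and five equations. -/
theorem exists_mem_homOp_graph (hl : ∀ j, 0 < l j) (ha : ∀ j, 0 < a j) (τ : ℝ) {z : ℂ}
    (hz : z.im ≠ 0) (h : HomSpace l) : ∃ x ∈ (homOp l a τ).graph, x.2 - z • x.1 = h := by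
  have hsym := isSymmetricGraph_homOp (a := a) hl τ
  rw [homOp_graph l a hl] at hsym ⊢
  have hκ : ∀ j, a j ^ 2 ≠ 0 := fun j => pow_ne_zero 2 (ha j).ne'
  let M₁ := edgeSpace (l 0) (a 0 ^ 2) τ
  let M₂ := edgeSpace (l 1) (a 1 ^ 2) τ
  let π₁ : M₁ × M₂ × ℂ →ₗ[ℂ] M₁ := LinearMap.fst ℂ M₁ (M₂ × ℂ)
  let π₂ : M₁ × M₂ × ℂ →ₗ[ℂ] M₂ := LinearMap.fst ℂ M₂ ℂ ∘ₗ LinearMap.snd ℂ M₁ (M₂ × ℂ)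
  let π₃ : M₁ × M₂ × ℂ →ₗ[ℂ] ℂ := LinearMap.snd ℂ M₂ ℂ ∘ₗ LinearMap.snd ℂ M₁ (M₂ × ℂ)
  let b : M₁ × M₂ × ℂ →ₗ[ℂ] ℂ := (1 / ((√(l 2) : ℝ) : ℂ)) • π₃
  let F : M₁ × M₂ × ℂ →ₗ[ℂ] ℂ := (a 1 : ℂ) ^ 2 • (edgeSpace.cov _ _ _ 0 ∘ₗ π₂)
    - ((a 1 : ℂ) ^ 2 * conj (xiTwo l τ)) • (edgeSpace.cov _ _ _ (l 1) ∘ₗ π₂)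
    + ((a 0 : ℂ) ^ 2 * conj (xiOne l τ)) • (edgeSpace.cov _ _ _ 0 ∘ₗ π₁)
    - (a 0 : ℂ) ^ 2 • (edgeSpace.cov _ _ _ (l 0) ∘ₗ π₁)
  -- Four matching conditions with `β/√l₃`; the last entry is the scalar component of the resolvent
  -- equation, which is treated as a boundary condition.
  let B : M₁ × M₂ × ℂ →ₗ[ℂ] (Fin 5 → ℂ) := LinearMap.pi
    ![edgeSpace.val _ _ _ 0 ∘ₗ π₂ - b,
      conj (xiTwo l τ) • (edgeSpace.val _ _ _ (l 1) ∘ₗ π₂) - b,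
      conj (xiOne l τ) • (edgeSpace.val _ _ _ 0 ∘ₗ π₁) - b,
      edgeSpace.val _ _ _ (l 0) ∘ₗ π₁ - b,
      (-(1 / ((√(l 2) : ℝ) : ℂ))) • F - z • π₃]
  let S : M₁ × M₂ × ℂ →ₗ[ℂ] EdgeL2 (l 0) × EdgeL2 (l 1) :=
    (edgeSpace.shift _ _ _ z ∘ₗ π₁).prod (edgeSpace.shift _ _ _ z ∘ₗ π₂)
  let u : M₁ × M₂ × ℂ → HomSpace l := fun m =>
    WithLp.toLp 2 (m.1.1.1, WithLp.toLp 2 (m.2.1.1.1, m.2.2))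
  let f : M₁ × M₂ × ℂ → HomSpace l := fun m =>
    WithLp.toLp 2 (m.1.1.2.1, WithLp.toLp 2 (m.2.1.1.2.1, -(1 / ((√(l 2) : ℝ) : ℂ)) * F m))
  have hmem : ∀ (m : M₁ × M₂ × ℂ) (δ : ℂ), B m = ![0, 0, 0, 0, δ] → (u m, f m) ∈ homGraph l a τ := by
    intro m δ hm
    have hb : b m = m.2.2 / (√(l 2) : ℝ) := one_div_mul_eq_div _ _
    refine ⟨m.1.1.2.2.1, m.1.1.2.2.2.1, m.2.1.1.2.2.1, m.2.1.1.2.2.2.1, m.1.1.2.2.2.2,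
      m.2.1.1.2.2.2.2, m.1.2.1, m.2.1.2.1, ⟨?_, ?_, ?_, ?_⟩, m.1.2.2, m.2.1.2.2, rfl⟩
    · exact (sub_eq_zero.1 (congrFun hm 0)).trans hb
    · exact (sub_eq_zero.1 (congrFun hm 1)).trans hb
    · exact (sub_eq_zero.1 (congrFun hm 2)).trans hb
    · exact (sub_eq_zero.1 (congrFun hm 3)).trans hb
  have hshift : ∀ (m : M₁ × M₂ × ℂ) (δ : ℂ), B m = ![0, 0, 0, 0, δ] → f m - z • u m =
      WithLp.toLp 2 ((S m).1, WithLp.toLp 2 ((S m).2, δ)) := by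
    intro m δ hm
    have h4 : -(1 / ((√(l 2) : ℝ) : ℂ)) * F m - z * m.2.2 = δ := congrFun hm 4
    rw [← h4]
    rfl
  obtain ⟨J₁, hJ₁⟩ := edgeSpace.exists_cauchyMap (hl 0).le (hκ 0) τ z
  obtain ⟨J₂, hJ₂⟩ := edgeSpace.exists_cauchyMap (hl 1).le (hκ 1) τ z
  let J : (ℂ × ℂ) × (ℂ × ℂ) × ℂ →ₗ[ℂ] M₁ × M₂ × ℂ := J₁.prodMap (J₂.prodMap LinearMap.id)
  have hzero : (0 : Fin 5 → ℂ) = ![0, 0, 0, 0, 0] := by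
    funext i; fin_cases i <;> rfl
  obtain ⟨m, hm1, hm2⟩ := exists_eq_and_eq_of_injective S B J
    (fun k => by
      obtain ⟨m₁, hm₁⟩ := edgeSpace.shift_surjective (τ := τ) (hl 0).le (hκ 0) z k.1
      obtain ⟨m₂, hm₂⟩ := edgeSpace.shift_surjective (τ := τ) (hl 1).le (hκ 1) z k.2
      exact ⟨(m₁, m₂, 0), Prod.ext hm₁ hm₂⟩)
    (fun v => Prod.ext (hJ₁ v.1).1 (hJ₂ v.2.1).1)
    (by simp)
    (fun v hv => by
      rw [hzero] at hv
      have h2 := hsym.abs_im_mul_norm_le (hmem _ _ hv) z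
      have h3 : S (J v) = 0 := Prod.ext (hJ₁ v.1).1 (hJ₂ v.2.1).1
      dsimp only at h2
      rw [hshift _ _ hv, h3] at h2
      have h3' : (WithLp.toLp 2 ((0 : EdgeL2 (l 0) × EdgeL2 (l 1)).1,
        WithLp.toLp 2 ((0 : EdgeL2 (l 0) × EdgeL2 (l 1)).2, (0 : ℂ))) : HomSpace l) = 0 := rfl
      rw [h3', norm_zero] at h2
      have h4 : u (J v) = 0 := norm_eq_zero.1
        (le_antisymm (by
          have := abs_pos.2 hz
          by_contra! hc
          exact absurd h2 (not_le.2 (mul_pos this hc))) (norm_nonneg _))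
      have e1 : (J₁ v.1).1.1 = 0 := congrArg (fun w : HomSpace l => w.fst) h4
      have e2 : (J₂ v.2.1).1.1 = 0 := congrArg (fun w : HomSpace l => w.snd.fst) h4
      have e3 : v.2.2 = 0 := congrArg (fun w : HomSpace l => w.snd.snd) h4
      have h6 := edgeSpace.eq_zero_of_fst_eq_zero (hl 0) e1
      rw [(hJ₁ v.1).2.1, (hJ₁ v.1).2.2] at h6
      have h7 := edgeSpace.eq_zero_of_fst_eq_zero (hl 1) e2
      rw [(hJ₂ v.2.1).2.1, (hJ₂ v.2.1).2.2] at h7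
      exact Prod.ext (Prod.ext h6.1 h6.2) (Prod.ext (Prod.ext h7.1 h7.2) e3))
    (h.fst, h.snd.fst) ![0, 0, 0, 0, h.snd.snd]
  refine ⟨_, hmem m _ hm2, ?_⟩
  dsimp only
  rw [hshift m _ hm2, hm1]
  rfl

theorem isSelfAdjoint_homOp (hl : ∀ j, 0 < l j) (ha : ∀ j, 0 < a j) (τ : ℝ) :
    IsSelfAdjoint (homOp l a τ) :=
  (isSymmetricGraph_homOp hl τ).isSelfAdjoint Complex.I
    (exists_mem_homOp_graph hl ha τ (by simp)) (exists_mem_homOp_graph hl ha τ (by simp))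

end homogenised

/-! ### The partial isometry -/

section partialIsometry

variable {l a : Fin 3 → ℝ}

theorem Psi_graphTriple (τ : ℝ) (u₀ : EdgeL2 (l 0)) (u₁ : EdgeL2 (l 1)) (u₂ : EdgeL2 (l 2)) :
    Psi l a τ (graphTriple l a u₀ u₁ u₂) =
      WithLp.toLp 2 (u₀, WithLp.toLp 2 (u₁, inner ℂ (stiffModeL2 l τ) u₂)) := rfl

theorem exists_eq_graphTriple (u : (softConnectedGraph l a).L2) :
    ∃ u₀ u₁ u₂, u = graphTriple l a u₀ u₁ u₂ := by
  refine ⟨u 0, u 1, u 2, ?_⟩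
  ext1 e
  fin_cases e <;> rfl

theorem graphTriple_norm_sq (u₀ : EdgeL2 (l 0)) (u₁ : EdgeL2 (l 1)) (u₂ : EdgeL2 (l 2)) :
    ‖graphTriple l a u₀ u₁ u₂‖ ^ 2 = ‖u₀‖ ^ 2 + ‖u₁‖ ^ 2 + ‖u₂‖ ^ 2 := by
  rw [PiLp.norm_sq_eq_of_L2, Fin.sum_univ_three]
  rfl

/-- The kernel contains every function supported on the stiff edge and orthogonal to the unit vector
`ψ`. Orthogonality to the kernel thus forces the stiff component to be a multiple of `ψ`, whose norm
is the modulus of its coefficient. -/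
theorem isPartialIsometry_Psi (hl : ∀ j, 0 < l j) (τ : ℝ) : IsPartialIsometry (Psi l a τ) := by
  intro x hx
  obtain ⟨x₀, x₁, x₂, rfl⟩ := exists_eq_graphTriple x
  have hψ := norm_stiffModeL2 (hl 2) τ
  set ψ := stiffModeL2 l τ with hψd
  set d : EdgeL2 (l 2) := x₂ - (inner ℂ ψ x₂ : ℂ) • ψ with hd
  have hψ1 : (inner ℂ ψ ψ : ℂ) = 1 := by rw [inner_self_eq_norm_sq_to_K, hψ]; simp
  have hψd0 : (inner ℂ ψ d : ℂ) = 0 := by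
    rw [hd, inner_sub_right, inner_smul_right, hψ1, mul_one, sub_self]
  have hker : graphTriple l a 0 0 d ∈ LinearMap.ker (Psi l a τ).toLinearMap := by
    rw [LinearMap.mem_ker]
    change Psi l a τ (graphTriple l a 0 0 d) = 0
    rw [Psi_graphTriple, ← hψd, hψd0]
    rfl
  have h0 := (Submodule.mem_orthogonal _ _).1 hx _ hker
  rw [graphTriple_inner, inner_zero_left, inner_zero_left, zero_add, zero_add] at h0
  have h1 : (inner ℂ d d : ℂ) = 0 := by
    nth_rewrite 2 [hd]
    rw [inner_sub_right, inner_smul_right, h0, ← inner_conj_symm d ψ, hψd0]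
    simp
  have h2 : x₂ = (inner ℂ ψ x₂ : ℂ) • ψ := sub_eq_zero.1 (inner_self_eq_zero.1 h1)
  have h3 : ‖x₂‖ = ‖(inner ℂ ψ x₂ : ℂ)‖ := by
    conv_lhs => rw [h2]
    rw [norm_smul, hψ, mul_one]
  have h4 : ‖Psi l a τ (graphTriple l a x₀ x₁ x₂)‖ ^ 2 = ‖graphTriple l a x₀ x₁ x₂‖ ^ 2 := by
    rw [Psi_graphTriple, WithLp.prod_norm_sq_eq_of_L2, WithLp.prod_norm_sq_eq_of_L2,
      graphTriple_norm_sq, h3]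
    change ‖x₀‖ ^ 2 + (‖x₁‖ ^ 2 + ‖(inner ℂ ψ x₂ : ℂ)‖ ^ 2) = _
    ring
  exact (sq_eq_sq₀ (norm_nonneg _) (norm_nonneg _)).1 h4

end partialIsometry

/-! ### Estimates on the stiff edge and for the soft fluxes -/

section estimates

variable {l a : Fin 3 → ℝ}

/-- On the soft edges the co-derivatives are controlled by the graph norm. -/
theorem exists_norm_soft_covDeriv_le (hl : ∀ j, 0 < l j) (ha : ∀ j, 0 < a j) : ∃ C : ℝ, 0 ≤ C ∧
    ∀ (ε τ : ℝ) (u f : (softConnectedGraph l a).L2) (p q : Fin 3 → ℝ → ℂ)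
      (g : (softConnectedGraph l a).L2) (c : Fin 2 → ℂ), ε ≠ 0 →
      (softConnectedGraph l a).IsContinuousSol ε τ u f p q g c →
      (∀ x ∈ Icc 0 (l 0), ‖covDeriv τ (p 0) (q 0) x‖ ≤ C * (‖u‖ + ‖f‖)) ∧
      ∀ x ∈ Icc 0 (l 1), ‖covDeriv τ (p 1) (q 1) x‖ ≤ C * (‖u‖ + ‖f‖) := by
  have a0 := ha 0
  have a1 := ha 1
  obtain ⟨C₀, hC₀, h₀⟩ := exists_norm_covDeriv_le (κ := a 0 ^ 2) (hl 0) (by positivity)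
  obtain ⟨C₁, hC₁, h₁⟩ := exists_norm_covDeriv_le (κ := a 1 ^ 2) (hl 1) (by positivity)
  refine ⟨max C₀ C₁, hC₀.trans (le_max_left _ _), fun ε τ u f p q g c hε h => ?_⟩
  have hA₀ := h.action 0
  rw [softConnectedGraph_kappa_zero l a hε] at hA₀
  have hA₁ := h.action 1
  rw [softConnectedGraph_kappa_one l a hε] at hA₁
  constructor
  · intro x hx
    exact (h₀ τ _ _ _ _ _ (h.w22 0) hA₀ x hx).trans (mul_le_mul (le_max_left _ _)
      (add_le_add (PiLp.norm_apply_le u 0) (PiLp.norm_apply_le f 0))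
      (add_nonneg (norm_nonneg _) (norm_nonneg _))
      (hC₀.trans (le_max_left _ _)))
  · intro x hx
    exact (h₁ τ _ _ _ _ _ (h.w22 1) hA₁ x hx).trans (mul_le_mul (le_max_right _ _)
      (add_le_add (PiLp.norm_apply_le u 1) (PiLp.norm_apply_le f 1))
      (add_nonneg (norm_nonneg _) (norm_nonneg _))
      (hC₀.trans (le_max_left _ _)))

/-- Without stiff flux at `V₁` the large coefficient `a₃²/ε²` drops out, and only soft
co-derivatives remain. -/
theorem exists_norm_normalSum_le (hl : ∀ j, 0 < l j) (ha : ∀ j, 0 < a j) : ∃ C : ℝ, 0 ≤ C ∧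
    ∀ (ε τ : ℝ) (u f : (softConnectedGraph l a).L2) (p q : Fin 3 → ℝ → ℂ)
      (g : (softConnectedGraph l a).L2) (c : Fin 2 → ℂ), ε ≠ 0 →
      (softConnectedGraph l a).IsContinuousSol ε τ u f p q g c →
      covDeriv τ (p 2) (q 2) (l 2) = 0 →
      ‖(softConnectedGraph l a).normalSum ε τ p q 0‖ ≤ C * (‖u‖ + ‖f‖) := by
  obtain ⟨C, hC, h⟩ := exists_norm_soft_covDeriv_le hl ha
  refine ⟨a 1 ^ 2 * C + a 0 ^ 2 * C, by positivity, fun ε τ u f p q g c hε hs h2 => ?_⟩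
  obtain ⟨h0, h1⟩ := h ε τ u f p q g c hε hs
  rw [softConnectedGraph_normalSum_zero l a hε, h2, mul_zero, sub_zero]
  refine (norm_sub_le _ _).trans ?_
  simp only [norm_mul, norm_pow, Complex.norm_real, Real.norm_eq_abs, sq_abs]
  have b0 := mul_le_mul_of_nonneg_left (h0 (l 0) ⟨(hl 0).le, le_rfl⟩) (sq_nonneg (a 0))
  have b1 := mul_le_mul_of_nonneg_left (h1 0 ⟨le_rfl, (hl 1).le⟩) (sq_nonneg (a 1))
  linarith

/-- The source of `ε²`. The Kirchhoff condition at `V₂` bounds `κ₃ ∂u₃(0)` by soft co-derivatives,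
and the variation of `e^{iτx} ∂u₃` along the edge is at most a constant times `‖f₃‖/κ₃`. -/
theorem exists_norm_stiff_covDeriv_le (hl : ∀ j, 0 < l j) (ha : ∀ j, 0 < a j) : ∃ C : ℝ, 0 ≤ C ∧
    ∀ (ε τ : ℝ) (u f : (softConnectedGraph l a).L2) (p q : Fin 3 → ℝ → ℂ)
      (g : (softConnectedGraph l a).L2) (c : Fin 2 → ℂ), 0 < ε →
      (softConnectedGraph l a).IsContinuousSol ε τ u f p q g c →
      (softConnectedGraph l a).normalSum ε τ p q 1 = 0 →
      ∀ x ∈ Icc 0 (l 2), ‖covDeriv τ (p 2) (q 2) x‖ ≤ C * ε ^ 2 * (‖u‖ + ‖f‖) := by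
  have a2 := ha 2
  obtain ⟨C, hC, h⟩ := exists_norm_soft_covDeriv_le hl ha
  obtain ⟨D, hD, h'⟩ := exists_norm_gauge_covDeriv_sub_le (hl 2).le
  refine ⟨(a 0 ^ 2 * C + a 1 ^ 2 * C + D) / a 2 ^ 2, by positivity,
    fun ε τ u f p q g c hε hs hN x hx => ?_⟩
  obtain ⟨h0, h1⟩ := h ε τ u f p q g c hε.ne' hs
  rw [softConnectedGraph_normalSum_one l a hε.ne'] at hN
  have hκ : 0 < a 2 ^ 2 / ε ^ 2 := by positivity
  have hA := hs.action 2
  rw [softConnectedGraph_kappa_two] at hA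
  have h2 := h' _ τ _ _ _ _ _ hκ (hs.w22 2) hA x hx
  have hf : ‖f 2‖ ≤ ‖u‖ + ‖f‖ :=
    (PiLp.norm_apply_le f 2).trans (le_add_of_nonneg_left (norm_nonneg u))
  have e1 : a 2 ^ 2 / ε ^ 2 * ‖covDeriv τ (p 2) (q 2) 0‖
      ≤ (a 0 ^ 2 * C + a 1 ^ 2 * C) * (‖u‖ + ‖f‖) := by
    have e2 : ((a 2 ^ 2 / ε ^ 2 : ℝ) : ℂ) * covDeriv τ (p 2) (q 2) 0
        = (a 1 : ℂ) ^ 2 * covDeriv τ (p 1) (q 1) (l 1)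
        - Complex.exp (Complex.I * τ * l 2) * (a 0 : ℂ) ^ 2 * covDeriv τ (p 0) (q 0) 0 := by
      linear_combination hN
    have e3 := congrArg norm e2
    rw [norm_mul, Complex.norm_real, Real.norm_of_nonneg hκ.le] at e3
    rw [e3]
    refine (norm_sub_le _ _).trans ?_
    have e4 : ‖Complex.exp (Complex.I * τ * l 2)‖ = 1 := by
      rw [show Complex.I * τ * l 2 = ((τ * l 2 : ℝ) : ℂ) * Complex.I by push_cast; ring,
        Complex.norm_exp_ofReal_mul_I]
    simp only [norm_mul, norm_pow, Complex.norm_real, Real.norm_eq_abs, sq_abs, e4, one_mul]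
    have b0 := mul_le_mul_of_nonneg_left (h0 0 ⟨le_rfl, (hl 0).le⟩) (sq_nonneg (a 0))
    have b1 := mul_le_mul_of_nonneg_left (h1 (l 1) ⟨(hl 1).le, le_rfl⟩) (sq_nonneg (a 1))
    linarith
  have e5 := norm_sub_norm_le (conj (edgePhase τ x) * covDeriv τ (p 2) (q 2) x)
    (covDeriv τ (p 2) (q 2) 0)
  rw [norm_mul, RCLike.norm_conj, norm_edgePhase, one_mul] at e5
  have e6 : a 2 ^ 2 / ε ^ 2 * ‖covDeriv τ (p 2) (q 2) x‖
      ≤ (a 0 ^ 2 * C + a 1 ^ 2 * C + D) * (‖u‖ + ‖f‖) := by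
    have e7 := mul_le_mul_of_nonneg_left (e5.trans h2) hκ.le
    rw [← mul_assoc, mul_div_cancel₀ _ hκ.ne'] at e7
    have e8 := e7.trans (mul_le_mul_of_nonneg_left hf hD)
    linarith
  rw [div_mul_eq_mul_div, div_le_iff₀ (by positivity)] at e6
  rw [div_mul_eq_mul_div, div_mul_eq_mul_div, le_div_iff₀ (by positivity)]
  linarith

/-- On the stiff edge, solutions are `O(ε²)`-close to a multiple of the stiff mode. -/
theorem exists_stiff_edge_estimate (hl : ∀ j, 0 < l j) (ha : ∀ j, 0 < a j) : ∃ C : ℝ, 0 ≤ C ∧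
    ∀ (ε τ : ℝ) (u₀ : EdgeL2 (l 0)) (u₁ : EdgeL2 (l 1)) (u₂ : EdgeL2 (l 2))
      (f : (softConnectedGraph l a).L2) (p q : Fin 3 → ℝ → ℂ)
      (g : (softConnectedGraph l a).L2) (c : Fin 2 → ℂ), 0 < ε →
      (softConnectedGraph l a).IsContinuousSol ε τ (graphTriple l a u₀ u₁ u₂) f p q g c →
      (softConnectedGraph l a).normalSum ε τ p q 1 = 0 →
      ‖c 0 - conj (xiTwo l τ) * c 1‖ ≤ C * ε ^ 2 * (‖graphTriple l a u₀ u₁ u₂‖ + ‖f‖) ∧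
      ‖u₂ - (c 1 * conj (xiTwo l τ) * (√(l 2) : ℝ)) • stiffModeL2 l τ‖
        ≤ C * ε ^ 2 * (‖graphTriple l a u₀ u₁ u₂‖ + ‖f‖) := by
  obtain ⟨C, hC, h⟩ := exists_norm_stiff_covDeriv_le hl ha
  obtain ⟨D, hD, hDb⟩ := EdgeL2.exists_norm_le_of_bound (l 2)
  have l2 := hl 2
  have hs : ((√(l 2) : ℝ) : ℂ) ≠ 0 := by
    exact_mod_cast (Real.sqrt_pos.2 (hl 2)).ne'
  -- The factor `1` serves the pointwise bound at `V₁`; `D` converts a supremum bound into an `L²`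
  -- bound.
  refine ⟨max 1 D * (C * l 2), by positivity, fun ε τ u₀ u₁ u₂ f p q g c hε hsol hN => ?_⟩
  have hb := h ε τ _ f p q g c hε hsol hN
  set B := C * ε ^ 2 * (‖graphTriple l a u₀ u₁ u₂‖ + ‖f‖) with hB
  have hB0 : 0 ≤ B := by positivity
  have hW : IsW22 (l 2) u₂ (p 2) (q 2) (g 2) := hsol.w22 2
  have hc1 : p 2 0 = c 1 := by simpa [softConnectedGraph] using hsol.left 2
  have hc0 : conj (xiTwo l τ) * conj (edgePhase τ (l 2)) * p 2 (l 2) = c 0 := by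
    rw [← exp_eq_conj_xiTwo_mul]
    exact hsol.right 2
  -- Integrating the co-derivative from `V₂` shows that `e^{iτx} u₃` is nearly the constant `c 1`.
  -- The endpoint `x = l 2` gives the first claim, the whole interval the second.
  have hY : ∀ x ∈ Icc 0 (l 2), ‖conj (edgePhase τ x) * p 2 x - c 1‖ ≤ B * l 2 := by
    intro x hx
    have e := hW.gauge_isPrimitiveOn (τ := τ) (hl 2).le x hx
    simp only [edgePhase_zero, map_one, one_mul, hc1] at e
    rw [e, add_sub_cancel_left]
    refine (intervalIntegral.norm_integral_le_of_norm_le_const (C := B) fun t ht => ?_).trans ?_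
    · rw [uIoc_of_le hx.1] at ht
      rw [norm_mul, RCLike.norm_conj, norm_edgePhase, one_mul]
      exact hb t ⟨ht.1.le, ht.2.trans hx.2⟩
    · rw [sub_zero, abs_of_nonneg hx.1]
      exact mul_le_mul_of_nonneg_left hx.2 hB0
  have hmax : max 1 D * (C * l 2) * ε ^ 2 * (‖graphTriple l a u₀ u₁ u₂‖ + ‖f‖)
      = max 1 D * (B * l 2) := by rw [hB]; ring
  have hBl : 0 ≤ B * l 2 := by positivity
  rw [hmax]
  constructor
  · refine le_trans ?_ (le_mul_of_one_le_left hBl (le_max_left 1 D))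
    rw [← hc0, mul_assoc, ← mul_sub, norm_mul, RCLike.norm_conj, norm_xiTwo, one_mul]
    exact hY (l 2) ⟨(hl 2).le, le_rfl⟩
  · refine le_trans ?_ (mul_le_mul_of_nonneg_right (le_max_right 1 D) hBl)
    refine hDb _ _ hBl ?_
    filter_upwards [hW.repr, MemLp.coeFn_toLp (memLp_stiffMode l τ),
      Lp.coeFn_sub u₂ ((c 1 * conj (xiTwo l τ) * (√(l 2) : ℝ)) • stiffModeL2 l τ),
      Lp.coeFn_smul (c 1 * conj (xiTwo l τ) * ((√(l 2) : ℝ) : ℂ)) (stiffModeL2 l τ),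
      ae_restrict_mem measurableSet_Ioo] with x h1 h2 h3 h4 hx
    have h5 := hY x (Ioo_subset_Icc_self hx)
    rw [h3, Pi.sub_apply, h4, Pi.smul_apply, h1, stiffModeL2, h2, stiffMode_eq, smul_eq_mul]
    have e1 := conj_edgePhase_mul τ x
    have e2 := conj_xiTwo_mul l τ
    have e3 : p 2 x - c 1 * conj (xiTwo l τ) * (√(l 2) : ℝ) *
        (edgePhase τ x * (xiTwo l τ / (√(l 2) : ℝ)))
        = edgePhase τ x * (conj (edgePhase τ x) * p 2 x - c 1) := by
      field_simp
      linear_combination (-p 2 x) * e1 - c 1 * edgePhase τ x * e2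
    rw [e3, norm_mul, norm_edgePhase, one_mul]
    exact h5

end estimates

/-! ### The resolvent estimate -/

section resolvent

variable {l a : Fin 3 → ℝ}

/-- The form of the difference of the resolvents, where `(u', f')` belongs to the graph of the
fibre operator and `x` to the graph of the homogenised operator. -/
theorem inner_sub_inner_graphTriple (hl : ∀ j, 0 < l j) {ε τ : ℝ} {z : ℂ}
    {u₀ f₀ : EdgeL2 (l 0)} {u₁ f₁ : EdgeL2 (l 1)} {u₂ f₂ : EdgeL2 (l 2)}
    {F : (softConnectedGraph l a).L2} {p q : Fin 3 → ℝ → ℂ} {g : (softConnectedGraph l a).L2}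
    {c : Fin 2 → ℂ}
    (h : (softConnectedGraph l a).IsContinuousSol ε τ (graphTriple l a u₀ u₁ u₂) F p q g c)
    (hK : ∀ v, (softConnectedGraph l a).normalSum ε τ p q v = 0)
    {x : HomSpace l × HomSpace l}
    (hx : x.2 - z • x.1 = Psi l a τ (graphTriple l a f₀ f₁ f₂))
    {p' q' : Fin 3 → ℝ → ℂ} {g' : (softConnectedGraph l a).L2}
    (h' : (softConnectedGraph l a).IsContinuousSol ε τ
      (graphTriple l a x.1.fst x.1.snd.fst (x.1.snd.snd • stiffModeL2 l τ))
      (graphTriple l a x.2.fst x.2.snd.fst 0) p' q' g'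
      ![x.1.snd.snd / (√(l 2) : ℝ), xiTwo l τ * (x.1.snd.snd / (√(l 2) : ℝ))])
    (hN : (softConnectedGraph l a).normalSum ε τ p' q' 0
        + conj (xiTwo l τ) * (softConnectedGraph l a).normalSum ε τ p' q' 1
        = -((√(l 2) : ℝ) * x.2.snd.snd)) :
    inner ℂ (graphTriple l a u₀ u₁ u₂) (graphTriple l a f₀ f₁ f₂)
      - inner ℂ (F - conj z • graphTriple l a u₀ u₁ u₂)
        (graphTriple l a x.1.fst x.1.snd.fst (x.1.snd.snd • stiffModeL2 l τ))
      = inner ℂ (u₂ - (c 1 * conj (xiTwo l τ) * (√(l 2) : ℝ)) • stiffModeL2 l τ)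
          (f₂ + (z * x.1.snd.snd) • stiffModeL2 l τ)
        + conj (c 0 - conj (xiTwo l τ) * c 1)
          * (softConnectedGraph l a).normalSum ε τ p' q' 0 := by
  have hG := h.green (fun e => (hl e).le) (softConnectedGraph_conj_wLeft_mul l a τ)
    (softConnectedGraph_conj_wRight_mul l a τ) h'
  have hx0 : x.2.fst - z • x.1.fst = f₀ := congrArg (fun w : HomSpace l => w.fst) hx
  have hx1 : x.2.snd.fst - z • x.1.snd.fst = f₁ := congrArg (fun w : HomSpace l => w.snd.fst) hx
  have hx2 : x.2.snd.snd - z * x.1.snd.snd = inner ℂ (stiffModeL2 l τ) f₂ :=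
    congrArg (fun w : HomSpace l => w.snd.snd) hx
  have hψ : (inner ℂ (stiffModeL2 l τ) (stiffModeL2 l τ) : ℂ) = 1 := by
    rw [inner_self_eq_norm_sq_to_K, norm_stiffModeL2 (hl 2)]; simp
  rw [graphTriple_inner (a := a) u₀ _ u₁ _ u₂ _] at hG
  simp only [hK, map_zero, zero_mul, Finset.sum_const_zero, zero_sub, Fin.sum_univ_two,
    inner_zero_right, add_zero] at hG
  rw [inner_sub_left, inner_smul_left, Complex.conj_conj, graphTriple_inner, graphTriple_inner,
    ← hx0, ← hx1]
  simp only [inner_sub_left, inner_sub_right, inner_add_right, inner_smul_left, inner_smul_right,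
    map_mul, map_sub, Complex.conj_conj, Complex.conj_ofReal, hψ, ← hx2]
  have hξ := conj_xiTwo_mul l τ
  -- Green's formula leaves `conj (c 0)` and `conj (c 1)` times the two normal sums of the
  -- comparison function. Eliminating the sum at `V₂` by `hN` leaves the vertex mismatch times the
  -- sum at `V₁`, and a scalar term absorbed into the stiff-edge product.
  linear_combination -hG - (conj (c 1) * (softConnectedGraph l a).normalSum ε τ p' q' 1) * hξ
    + conj (c 1) * xiTwo l τ * hN

theorem norm_Psi_le (hl : ∀ j, 0 < l j) (τ : ℝ) (f : (softConnectedGraph l a).L2) :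
    ‖Psi l a τ f‖ ≤ ‖f‖ := by
  obtain ⟨f₀, f₁, f₂, rfl⟩ := exists_eq_graphTriple f
  refine (sq_le_sq₀ (norm_nonneg _) (norm_nonneg _)).1 ?_
  rw [Psi_graphTriple, WithLp.prod_norm_sq_eq_of_L2, WithLp.prod_norm_sq_eq_of_L2,
    graphTriple_norm_sq]
  change ‖f₀‖ ^ 2 + (‖f₁‖ ^ 2 + ‖(inner ℂ (stiffModeL2 l τ) f₂ : ℂ)‖ ^ 2) ≤ _
  have h := norm_inner_le_norm (𝕜 := ℂ) (stiffModeL2 l τ) f₂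
  rw [norm_stiffModeL2 (hl 2), one_mul] at h
  have := (sq_le_sq₀ (norm_nonneg _) (norm_nonneg _)).2 h
  linarith

theorem norm_graphTriple_smul_stiffMode (hl : ∀ j, 0 < l j) (τ : ℝ) (v : HomSpace l) :
    ‖graphTriple l a v.fst v.snd.fst (v.snd.snd • stiffModeL2 l τ)‖ = ‖v‖ := by
  refine (sq_eq_sq₀ (norm_nonneg _) (norm_nonneg _)).1 ?_
  rw [WithLp.prod_norm_sq_eq_of_L2, WithLp.prod_norm_sq_eq_of_L2, graphTriple_norm_sq, norm_smul,
    norm_stiffModeL2 (hl 2), mul_one, add_assoc]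

theorem norm_graphTriple_zero_le (v : HomSpace l) :
    ‖graphTriple l a v.fst v.snd.fst 0‖ ≤ ‖v‖ := by
  refine (sq_le_sq₀ (norm_nonneg _) (norm_nonneg _)).1 ?_
  rw [WithLp.prod_norm_sq_eq_of_L2, WithLp.prod_norm_sq_eq_of_L2, graphTriple_norm_sq, norm_zero]
  have := sq_nonneg ‖v.snd.snd‖
  linarith

theorem norm_snd_snd_le (v : HomSpace l) : ‖v.snd.snd‖ ≤ ‖v‖ := by
  refine (sq_le_sq₀ (norm_nonneg _) (norm_nonneg _)).1 ?_
  rw [WithLp.prod_norm_sq_eq_of_L2, WithLp.prod_norm_sq_eq_of_L2]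
  have := sq_nonneg ‖v.fst‖
  have := sq_nonneg ‖v.snd.fst‖
  linarith

theorem norm_third_le_graphTriple (f₀ : EdgeL2 (l 0)) (f₁ : EdgeL2 (l 1)) (f₂ : EdgeL2 (l 2)) :
    ‖f₂‖ ≤ ‖graphTriple l a f₀ f₁ f₂‖ := PiLp.norm_apply_le (graphTriple l a f₀ f₁ f₂) 2

/-- Identifies `Ψ*` with extension by the stiff mode, so the comparison function is `Ψ*` of the
homogenised solution. -/
theorem inner_adjoint_Psi (τ : ℝ) (w : (softConnectedGraph l a).L2) (v : HomSpace l) :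
    inner ℂ w (ContinuousLinearMap.adjoint (Psi l a τ) v)
      = inner ℂ w (graphTriple l a v.fst v.snd.fst (v.snd.snd • stiffModeL2 l τ)) := by
  obtain ⟨w₀, w₁, w₂, rfl⟩ := exists_eq_graphTriple w
  rw [ContinuousLinearMap.adjoint_inner_right, graphTriple_inner, Psi_graphTriple, homSpace_inner,
    inner_smul_right, ← add_assoc]
  congr 1
  change inner ℂ (inner ℂ (stiffModeL2 l τ) w₂ : ℂ) v.snd.snd = _
  rw [RCLike.inner_apply, inner_conj_symm]

theorem IsSymmetricGraph.norm_le {H : Type*} [NormedAddCommGroup H] [InnerProductSpace ℂ H]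
    {g : Submodule ℂ (H × H)} (hg : IsSymmetricGraph g) {x : H × H} (hx : x ∈ g) {z : ℂ}
    {σ Z : ℝ} (hσ : 0 < σ) (hz : σ ≤ |z.im|) (hZ : ‖z‖ ≤ Z) :
    ‖x.1‖ ≤ σ⁻¹ * ‖x.2 - z • x.1‖ ∧ ‖x.1‖ + ‖x.2‖ ≤ (σ⁻¹ + (1 + Z * σ⁻¹)) * ‖x.2 - z • x.1‖ := by
  have h0 : 0 ≤ Z := (norm_nonneg z).trans hZ
  have h1 : ‖x.1‖ ≤ σ⁻¹ * ‖x.2 - z • x.1‖ := by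
    rw [inv_mul_eq_div, le_div_iff₀ hσ, mul_comm]
    exact (mul_le_mul_of_nonneg_right hz (norm_nonneg _)).trans (hg.abs_im_mul_norm_le hx z)
  have h2 : ‖x.2‖ ≤ ‖x.2 - z • x.1‖ + Z * ‖x.1‖ := by
    calc ‖x.2‖ = ‖(x.2 - z • x.1) + z • x.1‖ := by rw [sub_add_cancel]
      _ ≤ ‖x.2 - z • x.1‖ + ‖z • x.1‖ := norm_add_le _ _
      _ ≤ _ := by rw [norm_smul]; gcongr
  have h3 := mul_le_mul_of_nonneg_left h1 h0
  exact ⟨h1, by linarith⟩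

theorem exists_resolvent_difference_bound (hl : ∀ j, 0 < l j) (ha : ∀ j, 0 < a j) {σ Z : ℝ}
    (hσ : 0 < σ) (hZ0 : 0 ≤ Z) : ∃ C : ℝ, 0 ≤ C ∧ ∀ ε : ℝ, 0 < ε → ∀ (τ : ℝ) (z : ℂ),
      ‖z‖ ≤ Z → σ ≤ |z.im| →
      ∀ (R : (softConnectedGraph l a).L2 →L[ℂ] (softConnectedGraph l a).L2)
        (R₀ : HomSpace l →L[ℂ] HomSpace l),
        IsResolventAt ((softConnectedGraph l a).fibreOp ε τ) z R →
        IsResolventAt (homOp l a τ) z R₀ →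
        ‖R - ContinuousLinearMap.adjoint (Psi l a τ) ∘L R₀ ∘L Psi l a τ‖ ≤ C * ε ^ 2 := by
  obtain ⟨M, hM, hstiff⟩ := exists_stiff_edge_estimate hl ha
  obtain ⟨N, hN, hflux⟩ := exists_norm_normalSum_le hl ha
  set T := σ⁻¹ + (1 + Z * σ⁻¹) with hT
  have hT0 : 0 ≤ T := by positivity
  -- `T` bounds the graph norm of a solution by its data, so `M * T * ε²` bounds both small factors;
  -- `1 + Z * σ⁻¹` and `N * T` bound their partners.
  refine ⟨M * T * (1 + Z * σ⁻¹ + N * T), by positivity, fun ε hε τ z hz hzσ R R₀ hR hR₀ => ?_⟩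
  have hsym := isSymmetricGraph_fibreOp (a := a) hl ε τ
  have hsym₀ := isSymmetricGraph_homOp (a := a) hl τ
  have hzim : z.im ≠ 0 := abs_pos.1 (hσ.trans_le hzσ)
  have key : ∀ f w : (softConnectedGraph l a).L2,
      ‖(inner ℂ w ((R - ContinuousLinearMap.adjoint (Psi l a τ) ∘L R₀ ∘L Psi l a τ) f) : ℂ)‖
        ≤ M * T * (1 + Z * σ⁻¹ + N * T) * ε ^ 2 * ‖f‖ * ‖w‖ := by
    intro f w
    -- Duality: `w` is written as `(A_ε - z̄) y.1`, which by symmetry turns `⟨w, R f⟩` into `⟨y.1,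
    -- f⟩`.
    obtain ⟨y, hy, hyw⟩ := exists_mem_fibreOp_graph hl ha hε τ (z := conj z)
      (by simpa using hzim) w
    have hyn := (hsym.norm_le hy (z := conj z) hσ (by simpa using hzσ)
      (by simpa using hz)).2
    have hRf := hR.mem_graph f
    have hx := hR₀.mem_graph (Psi l a τ f)
    obtain ⟨x, hxd⟩ : ∃ x, x = (R₀ (Psi l a τ f), Psi l a τ f + z • R₀ (Psi l a τ f)) := ⟨_, rfl⟩
    rw [← hxd] at hx
    have hx2 : x.2 - z • x.1 = Psi l a τ f := by rw [hxd]; simp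
    have hxn := hsym₀.norm_le hx hσ hzσ hz
    rw [hx2] at hxn
    have hPf := norm_Psi_le (a := a) hl τ f
    have e1 : inner ℂ w (R f) = inner ℂ y.1 f := by
      have h1 := hsym y hy _ hRf
      dsimp only at h1
      rw [inner_add_right, inner_smul_right] at h1
      rw [← hyw, inner_sub_left, inner_smul_left, Complex.conj_conj, h1]
      ring
    rw [homOp_graph l a hl] at hx
    rw [HighContrastGraph.fibreOp_graph _ hl] at hy
    obtain ⟨p', q', g', h', hp'2, hN'⟩ := exists_isContinuousSol_of_mem_homGraph hl hε.ne' hx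
    obtain ⟨p, q, g, c, h, hK⟩ := (HighContrastGraph.mem_fibreGraph_iff _ ε τ y).1 hy
    obtain ⟨u₀, u₁, u₂, hu⟩ := exists_eq_graphTriple y.1
    obtain ⟨f₀, f₁, f₂, hf⟩ := exists_eq_graphTriple f
    have hf2 : ‖f₂‖ ≤ ‖f‖ := by rw [hf]; exact norm_third_le_graphTriple f₀ f₁ f₂
    rw [hu] at h
    have e2 := inner_sub_inner_graphTriple hl h hK (by rw [hx2, hf]) h' hN'
    rw [← hu, ← hf, hyw, ← e1, ← inner_adjoint_Psi, ← inner_sub_right] at e2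
    have e3 : (R - ContinuousLinearMap.adjoint (Psi l a τ) ∘L R₀ ∘L Psi l a τ) f
        = R f - ContinuousLinearMap.adjoint (Psi l a τ) x.1 := by rw [hxd]; rfl
    rw [e3, e2]
    obtain ⟨s1, s2⟩ := hstiff ε τ u₀ u₁ u₂ y.2 p q g c hε h (hK 1)
    rw [← hu] at s1 s2
    have s3 := hflux ε τ _ _ p' q' g' _ hε.ne' h' (hp'2 _)
    rw [norm_graphTriple_smul_stiffMode hl] at s3
    rw [hyw] at hyn
    have t1 : M * ε ^ 2 * (‖y.1‖ + ‖y.2‖) ≤ M * ε ^ 2 * (T * ‖w‖) := by gcongr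
    have t2 : ‖f₂ + (z * x.1.snd.snd) • stiffModeL2 l τ‖ ≤ (1 + Z * σ⁻¹) * ‖f‖ := by
      refine (norm_add_le _ _).trans ?_
      rw [norm_smul, norm_stiffModeL2 (hl 2), mul_one, norm_mul]
      have b1 : ‖x.1.snd.snd‖ ≤ σ⁻¹ * ‖f‖ := (norm_snd_snd_le x.1).trans
        (hxn.1.trans (mul_le_mul_of_nonneg_left hPf (by positivity)))
      have b2 := mul_le_mul hz b1 (norm_nonneg _) hZ0
      linarith
    have t3 : ‖(softConnectedGraph l a).normalSum ε τ p' q' 0‖ ≤ N * (T * ‖f‖) := by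
      refine s3.trans (mul_le_mul_of_nonneg_left ?_ hN)
      have b1 := norm_graphTriple_zero_le (a := a) x.2
      have b2 := mul_le_mul_of_nonneg_left hPf hT0
      linarith [hxn.2]
    refine (norm_add_le _ _).trans ?_
    have r1 := (norm_inner_le_norm (𝕜 := ℂ) (u₂ - (c 1 * conj (xiTwo l τ) * (√(l 2) : ℝ)) •
      stiffModeL2 l τ) (f₂ + (z * x.1.snd.snd) • stiffModeL2 l τ)).trans
      (mul_le_mul (s2.trans t1) t2 (norm_nonneg _) (by positivity))
    have r2 := mul_le_mul (s1.trans t1) t3 (norm_nonneg _) (by positivity)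
    rw [norm_mul, RCLike.norm_conj]
    refine (add_le_add r1 r2).trans (le_of_eq ?_)
    ring
  refine ContinuousLinearMap.opNorm_le_bound _ (by positivity) fun f => ?_
  -- Testing with the difference itself gives the squared norm on the left; one factor is then
  -- cancelled.
  have h := key f ((R - ContinuousLinearMap.adjoint (Psi l a τ) ∘L R₀ ∘L Psi l a τ) f)
  rw [inner_self_eq_norm_sq_to_K, norm_pow, RCLike.norm_ofReal, abs_norm, sq] at h
  rcases (norm_nonneg ((R - ContinuousLinearMap.adjoint (Psi l a τ) ∘L R₀ ∘L
    Psi l a τ) f)).eq_or_lt with h0 | h0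
  · rw [← h0]; positivity
  · exact le_of_mul_le_mul_right h h0

end resolvent

theorem mainTheorem3 (l a : Fin 3 → ℝ) (hl : ∀ j, 0 < l j) (hl1 : ∑ j, l j = 1)
    (ha : ∀ j, 0 < a j) :
    (∀ τ ∈ Set.Ico (-Real.pi) Real.pi,
      IsSelfAdjoint (homOp l a τ) ∧ IsPartialIsometry (Psi l a τ)) ∧
    ∀ K : Set ℂ, IsCompact K → ∀ σ : ℝ, 0 < σ →
      ∃ C : ℝ, ∀ ε : ℝ, 0 < ε → ∀ τ ∈ Set.Ico (-Real.pi) Real.pi,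
        ∀ z ∈ K, σ ≤ |z.im| →
          ∃ (R : (softConnectedGraph l a).L2 →L[ℂ] (softConnectedGraph l a).L2)
            (R₀ : HomSpace l →L[ℂ] HomSpace l),
            IsResolventAt ((softConnectedGraph l a).fibreOp ε τ) z R ∧
            IsResolventAt (homOp l a τ) z R₀ ∧
            ‖R - ContinuousLinearMap.adjoint (Psi l a τ) ∘L R₀ ∘L Psi l a τ‖ ≤ C * ε ^ 2 := by
  refine ⟨fun τ _ => ⟨isSelfAdjoint_homOp hl ha τ, isPartialIsometry_Psi hl τ⟩,
    fun K hK σ hσ => ?_⟩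
  obtain ⟨Z, hZ⟩ := hK.isBounded.exists_norm_le
  obtain ⟨C, -, hC⟩ := exists_resolvent_difference_bound hl ha hσ (abs_nonneg Z)
  refine ⟨C, fun ε hε τ _ z hzK hz => ?_⟩
  have hzim : z.im ≠ 0 := abs_pos.1 (hσ.trans_le hz)
  obtain ⟨R, hR⟩ := (isSymmetricGraph_fibreOp (a := a) hl ε τ).exists_isResolventAt hzim
    (exists_mem_fibreOp_graph hl ha hε τ hzim)
  obtain ⟨R₀, hR₀⟩ := (isSymmetricGraph_homOp (a := a) hl τ).exists_isResolventAt hzim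
    (exists_mem_homOp_graph hl ha τ hzim)
  exact ⟨R, R₀, hR, hR₀, hC ε hε τ z ((hZ z hzK).trans (le_abs_self Z)) hz R R₀ hR hR₀⟩
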